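/- Let $n\ge 1$ and consider the system $\dot x_i=x_{i+1}$ $(1\le i\le n-1)$, $\dot x_n=f(\mathbf x)+g(\mathbf x)u+d(t)$, $y=x_1$, where $f:\mathbb R^n\to\mathbb R$ is continuous, $g:\mathbb R^n\to\mathbb R$ satisfies $|g(\mathbf x)|\ge \underline g$ for all $\mathbf x$ with some constant $\underline g>0$, and $d:[0,\infty)\to\mathbb R$ is piecewise continuous (finitely many discontinuities in each bounded interval, one-sided limits everywhere) with $|d(t)|<\bar d$ for all $t\ge 0$ and some constant $\bar d>0$. Let $x_{des}$ be smooth on $[0,\infty)$, put $e=x_1-x_{des}$, $e^{(i)}=x_{i+1}-x_{des}^{(i)}$ for $0\le i\le n-1$, and $\sigma=c_1e^{(0)}+\dots+c_{n-1}e^{(n-2)}+e^{(n-1)}$ with real coefficients $c_1,\dots,c_{n-1}$. Let $\rho_0,\rho_\infty,\mu>0$, $\rho(t)=\rho_0e^{-\mu t}+\rho_\infty$, and apply the feedback $u=-\operatorname{sign}(g(\mathbf x))\tan\left(\frac{\pi\sigma}{2\rho(t)}\right)$. A trajectory on an interval is a continuous $\mathbf x(t)$ that satisfies the closed-loop equations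 at its interior times, the last equation being required only where $d$ is continuous. Fix an initial state with $|\sigma(0)|<\rho_0$. Then: (a) Every trajectory on $[0,T)$, $0<T\le\infty$, with this initial state satisfies $|\sigma(t)|<\rho(t)$ for all $t\in[0,T)$. If $g$ is continuous, then a trajectory on $[0,\infty)$ with this initial state exists, and every trajectory on $[0,T)$ with $T<\infty$ and this initial state extends to a trajectory on $[0,\infty)$. (b) For every trajectory on $[0,\infty)$ with this initial state and every $\varepsilon$ with $\rho_\infty<\varepsilon<\rho_0$, there is a time $t_r$ with $0\le t_r<\frac1\mu\ln\left(\frac{\rho_0}{\varepsilon-\rho_\infty}\right)$ such that $|\sigma(t)|<\varepsilon$ for all $t\ge t_r$; in particular the trajectory is in quasi-sliding mode with bandwidth $\varepsilon$, that is, $|\sigma(t)|\le\varepsilon$ for all $t>t_r$. (c) If moreover $c_i=\binom{n-1}{n-i}a^{n-i}$ for $1\le i\le n-1$ with some $a>0$, then for every trajectory and every $\varepsilon$ as in (b) there is a time after which $|e(t)|<\varepsilon/a^{n-1}$ and, more generally, $|e^{(i)}(t)|<(2a)^i\,\varepsilon/a^{n-1}$ for $0\le i\le n-1$. -/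

import Mathlib

open Set Filter Topology
open scoped ContDiff

namespace QSMC

noncomputable section

/-- Piecewise continuity on `[0, ∞)`: finitely many discontinuities in every bounded interval,
and one-sided limits everywhere. -/
def PiecewiseContinuous (d : ℝ → ℝ) : Prop :=
  (∀ T : ℝ, {t ∈ Ioo 0 T | ¬ ContinuousAt d t}.Finite) ∧
  (∀ t : ℝ, 0 ≤ t → ∃ l : ℝ, Tendsto d (𝓝[>] t) (𝓝 l)) ∧
  (∀ t : ℝ, 0 < t → ∃ l : ℝ, Tendsto d (𝓝[<] t) (𝓝 l))

/-- `x` is a trajectory on the time interval `J` of the system of order `n = m + 1`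
`x₁' = x₂, …, xₙ₋₁' = xₙ, xₙ' = f(x) + g(x) u + d(t)` under the feedback `u = u(t, x)`:
it is continuous and satisfies the differential equations in the interior of `J`, the last one
except at the points where the disturbance `d` is discontinuous. The state variable `xᵢ` is
coordinate `i - 1` in `Fin (m + 1)`. -/
structure IsTrajectoryOn {m : ℕ} (f g : (Fin (m + 1) → ℝ) → ℝ) (d : ℝ → ℝ)
    (u : ℝ → (Fin (m + 1) → ℝ) → ℝ) (J : Set ℝ) (x : ℝ → Fin (m + 1) → ℝ) : Prop where
  continuousOn : ContinuousOn x J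
  chain : ∀ t ∈ interior J, ∀ j : Fin m,
    HasDerivAt (fun s => x s j.castSucc) (x t j.succ) t
  last : ∀ t ∈ interior J, ContinuousAt d t →
    HasDerivAt (fun s => x s (Fin.last m)) (f (x t) + g (x t) * u t (x t) + d t) t

/-- The error coordinate `e^{(i)} = x_{i+1} - x_des^{(i)}`, `i = 0, …, n - 1`, at time `t` and
state `z`; the derivatives of `x_des` are taken on `[0, ∞)`, one-sided at `0`. -/
def err {m : ℕ} (xdes : ℝ → ℝ) (t : ℝ) (z : Fin (m + 1) → ℝ) (i : Fin (m + 1)) : ℝ :=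
  z i - iteratedDerivWithin (i : ℕ) xdes (Ici 0) t

/-- The sliding variable `σ = c₁ e^{(0)} + ⋯ + c_{n-1} e^{(n-2)} + e^{(n-1)}`. -/
def sigma {m : ℕ} (c : Fin m → ℝ) (xdes : ℝ → ℝ) (t : ℝ) (z : Fin (m + 1) → ℝ) : ℝ :=
  ∑ j : Fin m, c j * err xdes t z j.castSucc + err xdes t z (Fin.last m)

/-- The reaching bound `ρ(t) = ρ₀ e^{-μ t} + ρ_∞`. -/
def rho (ρ₀ ρinf μ t : ℝ) : ℝ := ρ₀ * Real.exp (-μ * t) + ρinf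

/-- The control law `u = -sign(g(x)) tan(π σ / (2 ρ(t)))`. -/
def control {m : ℕ} (g : (Fin (m + 1) → ℝ) → ℝ) (c : Fin m → ℝ) (xdes : ℝ → ℝ)
    (ρ₀ ρinf μ : ℝ) (t : ℝ) (z : Fin (m + 1) → ℝ) : ℝ :=
  -Real.sign (g z) * Real.tan (Real.pi * sigma c xdes t z / (2 * rho ρ₀ ρinf μ t))

/-- Quasi-sliding mode of bandwidth `ε` with reaching time `tr`. -/
def InQSM (s : ℝ → ℝ) (ε tr : ℝ) : Prop := ∀ t : ℝ, tr < t → |s t| ≤ ε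

end

end QSMC

namespace QSMC

/-! ### Peano existence by Euler's method -/

/-! Along a trajectory `σ' = drift + g u`, and the sign factor turns `g u` into `-|g| tan(πσ/(2ρ))`.
On a compact time interval the state, hence the drift, is bounded, whereas the tangent blows up as
`|σ|/ρ → 1`. So there is `θ' < 1` such that the input beats both the drift and the shrinking of `ρ`
wherever `|σ| ≥ θ'ρ`, and a trajectory starting with `|σ| < θρ`, `θ' < θ < 1`, keeps this inequality
(`abs_sigma_lt_of_drift_le`, resting on `neg_of_nonincreasing_near_zero`). This yields the funnel
bound `abs_sigma_lt_rho`.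

The funnel bounds `σ` by `ρ₀ + ρ_∞` for all trajectories alike. A Grönwall estimate for the errors
then bounds the state uniformly over all trajectories up to a given time (`exists_norm_bound`), and
with it the distance to the funnel wall (`exists_tube`). Global existence follows from Peano's
theorem `exists_solution` for a truncated field, because the a priori bound shows that the
truncation is never active (`exists_solution_of_tube`). Solutions need not be unique, so a given
trajectory is extended by solving a field that replays it before time `T`
(`isTrajectoryOn_of_replay`); nothing has to be glued at `T`.

The funnel has width `ε` at the stated time, and strictness of the bound lets the reaching time be
earlier. For binomial coefficients `σ = (d/dt + a)^(n-1) e`: undoing each factor is a stable filter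
of gain `1/a`, and each derivative is recovered as a difference, at the price of a factor `2a`
(`eventually_abs_lt_of_cascade`). -/

/-- The nodes of Euler's method with step `h` for `x' = F(t, x)`, `x(0) = x₀`. -/
noncomputable def eulerSeq {ι : Type*} (F : ℝ → (ι → ℝ) → ι → ℝ) (x₀ : ι → ℝ) (h : ℝ) :
    ℕ → ι → ℝ
  | 0 => x₀
  | j + 1 => fun i => eulerSeq F x₀ h j i + h * F (j * h) (eulerSeq F x₀ h j) i

/-- The piecewise constant path through the nodes of Euler's method. -/
noncomputable def eulerPath {ι : Type*} (F : ℝ → (ι → ℝ) → ι → ℝ) (x₀ : ι → ℝ) (h t : ℝ) :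
    ι → ℝ :=
  eulerSeq F x₀ h ⌊t / h⌋₊

section Euler

variable {ι : Type*} {F : ℝ → (ι → ℝ) → ι → ℝ} {x₀ : ι → ℝ} {h : ℝ}

/-- The increments telescope. The reference slope `v` serves two purposes: `v = 0` gives a Lipschitz
bound, and the value of the field at a limit point gives differentiability there. -/
theorem eulerSeq_increment (hh : 0 ≤ h) {i : ι} {v ε : ℝ} {j l : ℕ} (hjl : j ≤ l)
    (H : ∀ p, j ≤ p → p < l → |F (p * h) (eulerSeq F x₀ h p) i - v| ≤ ε) :
    |eulerSeq F x₀ h l i - eulerSeq F x₀ h j i - (l * h - j * h) * v| ≤ ε * (l * h - j * h) := by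
  induction l, hjl using Nat.le_induction with
  | base => simp
  | succ l hl ih =>
    have h1 := ih fun p hp hpl => H p hp (hpl.trans (Nat.lt_succ_self l))
    have h2 := H l hl (Nat.lt_succ_self l)
    have h3 : |h * (F (l * h) (eulerSeq F x₀ h l) i - v)| ≤ h * ε := by
      rw [abs_mul, abs_of_nonneg hh]
      gcongr
    have h4 := abs_add_le (eulerSeq F x₀ h l i - eulerSeq F x₀ h j i - (l * h - j * h) * v)
      (h * (F (l * h) (eulerSeq F x₀ h l) i - v))
    have h5 : eulerSeq F x₀ h (l + 1) i - eulerSeq F x₀ h j i - ((l + 1 : ℕ) * h - j * h) * v =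
        eulerSeq F x₀ h l i - eulerSeq F x₀ h j i - (l * h - j * h) * v +
        h * (F (l * h) (eulerSeq F x₀ h l) i - v) := by
      simp only [eulerSeq]
      push_cast
      ring
    rw [h5]
    push_cast
    linarith

theorem floor_div_mul_le (hh : 0 < h) {t : ℝ} (ht : 0 ≤ t) : (⌊t / h⌋₊ : ℝ) * h ≤ t :=
  (le_div_iff₀ hh).1 (Nat.floor_le (div_nonneg ht hh.le))

theorem lt_floor_div_mul_add (hh : 0 < h) (t : ℝ) : t < (⌊t / h⌋₊ : ℝ) * h + h := by
  have := (div_lt_iff₀ hh).1 (Nat.lt_floor_add_one (t / h))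
  linarith

theorem eulerPath_node (hh : 0 < h) (p : ℕ) :
    eulerPath F x₀ h (p * h) = eulerSeq F x₀ h p := by
  simp [eulerPath, hh.ne']

theorem eulerPath_of_nonpos (hh : 0 < h) {t : ℝ} (ht : t ≤ 0) : eulerPath F x₀ h t = x₀ := by
  have : ⌊t / h⌋₊ = 0 := Nat.floor_of_nonpos (div_nonpos_of_nonpos_of_nonneg ht hh.le)
  simp [eulerPath, this, eulerSeq]

/-- The path at `a` sits at the last node not after `a`, which may precede `a` by almost `h`; hence
the window starts at `a - h`, and elapsed time is measured between nodes. -/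
theorem eulerPath_increment (hh : 0 < h) {i : ι} {v ε a b : ℝ} (ha : 0 ≤ a) (hab : a ≤ b)
    (H : ∀ p : ℕ, a - h < p * h → p * h ≤ b →
      |F (p * h) (eulerPath F x₀ h (p * h)) i - v| ≤ ε) :
    |eulerPath F x₀ h b i - eulerPath F x₀ h a i - (⌊b / h⌋₊ * h - ⌊a / h⌋₊ * h) * v| ≤
      ε * (⌊b / h⌋₊ * h - ⌊a / h⌋₊ * h) := by
  refine eulerSeq_increment hh.le (Nat.floor_mono (by gcongr)) fun p hp hpb => ?_
  have h1 : (⌊a / h⌋₊ : ℝ) * h ≤ p * h := by gcongr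
  have h2 : (p : ℝ) * h ≤ ⌊b / h⌋₊ * h := by gcongr
  have h3 := lt_floor_div_mul_add hh a
  have h4 := floor_div_mul_le hh (ha.trans hab)
  rw [← eulerPath_node hh]
  exact H p (by linarith) (by linarith)

theorem eulerPath_lipschitz (hh : 0 < h) {i : ι} {B a b : ℝ}
    (hB : ∀ t, 0 ≤ t → t ≤ b → ∀ z, |F t z i| ≤ B) (ha : 0 ≤ a) (hab : a ≤ b) :
    |eulerPath F x₀ h b i - eulerPath F x₀ h a i| ≤ B * (b - a + h) := by
  have h1 := eulerPath_increment (F := F) (x₀ := x₀) (i := i) (v := 0) (ε := B) hh ha hab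
    fun p _ hpb => by
      rw [sub_zero]
      exact hB _ (by positivity) hpb _
  have h3 := lt_floor_div_mul_add hh a
  have h4 := floor_div_mul_le hh (ha.trans hab)
  have h5 : 0 ≤ B := (abs_nonneg _).trans (hB a ha hab x₀)
  rw [mul_zero, sub_zero] at h1
  refine h1.trans (mul_le_mul_of_nonneg_left (by linarith) h5)

theorem tendsto_floor_div_mul {l : Filter ℕ} {s : ℕ → ℝ} (hs : ∀ k, 0 < s k)
    (hs0 : Tendsto s l (𝓝 0)) {t : ℝ} (ht : 0 ≤ t) :
    Tendsto (fun k => (⌊t / s k⌋₊ : ℝ) * s k) l (𝓝 t) := by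
  have h1 : Tendsto (fun k => t - s k) l (𝓝 t) := by simpa using tendsto_const_nhds.sub hs0
  refine tendsto_of_tendsto_of_tendsto_of_le_of_le h1 tendsto_const_nhds (fun k => ?_)
    fun k => floor_div_mul_le (hs k) ht
  have := lt_floor_div_mul_add (hs k) t
  simp only
  linarith

end Euler

/-- **Peano's existence theorem**, global in time and componentwise: if `F` is bounded on
every strip `[0, N] × ℝ^ι`, there is a continuous path each of whose components solves the equation
at all times where the corresponding component of `F` is continuous along the path. -/
theorem exists_solution {ι : Type*} [Fintype ι] (F : ℝ → (ι → ℝ) → ι → ℝ) (x₀ : ι → ℝ)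
    (hF : ∀ N : ℕ, ∃ B : ℝ, ∀ t : ℝ, 0 ≤ t → t ≤ N → ∀ z i, |F t z i| ≤ B) :
    ∃ x : ℝ → ι → ℝ, x 0 = x₀ ∧ ContinuousOn x (Ici 0) ∧
      ∀ t, 0 < t → ∀ i, ContinuousAt (fun p : ℝ × (ι → ℝ) => F p.1 p.2 i) (t, x t) →
        HasDerivAt (fun s => x s i) (F t (x t) i) t := by
  -- A limit along a nonprincipal ultrafilter exists at every time at once, by boundedness alone,
  -- and so replaces the extraction of an Arzelà–Ascoli subsequence.
  set U : Ultrafilter ℕ := hyperfilter ℕ with hU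
  set s : ℕ → ℝ := fun k => 1 / ((k : ℝ) + 1) with hs
  have hs_pos : ∀ k, 0 < s k := fun k => by positivity
  have hs_le : ∀ k, s k ≤ 1 := fun k => by
    rw [hs]
    exact div_le_one_of_le₀ (by linarith [(Nat.cast_nonneg k : (0 : ℝ) ≤ k)]) (by positivity)
  have hs0 : Tendsto s U (𝓝 0) :=
    tendsto_one_div_add_atTop_nhds_zero_nat.mono_left Nat.hyperfilter_le_atTop
  have hlim : ∀ t i, ∃ y, Tendsto (fun k => eulerPath F x₀ (s k) t i) U (𝓝 y) := by
    intro t i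
    rcases le_total t 0 with ht | ht
    · exact ⟨x₀ i, by simp only [eulerPath_of_nonpos (hs_pos _) ht]; exact tendsto_const_nhds⟩
    · obtain ⟨N, hN⟩ := exists_nat_ge t
      obtain ⟨B, hB⟩ := hF N
      have hB0 : 0 ≤ B := (abs_nonneg _).trans (hB 0 le_rfl (by positivity) x₀ i)
      have hmem : ∀ k, eulerPath F x₀ (s k) t i ∈ Icc (x₀ i - B * (t + 1)) (x₀ i + B * (t + 1)) := by
        intro k
        have h1 := eulerPath_lipschitz (F := F) (x₀ := x₀) (i := i) (hs_pos k)
          (fun r hr hrt z => hB r hr (hrt.trans hN) z i) le_rfl ht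
        rw [eulerPath_of_nonpos (hs_pos k) le_rfl, abs_le] at h1
        have h2 : B * (t - 0 + s k) ≤ B * (t + 1) := by
          have := hs_le k
          gcongr
          linarith
        constructor <;> linarith [h1.1, h1.2]
      obtain ⟨y, -, hy⟩ := isCompact_Icc.ultrafilter_le_nhds
        (U.map fun k => eulerPath F x₀ (s k) t i)
        (by rw [le_principal_iff]; exact Eventually.of_forall (f := (U : Filter ℕ)) hmem)
      exact ⟨y, hy⟩
  choose x hx using hlim
  have hlip : ∀ (N : ℕ) (B : ℝ), (∀ t : ℝ, 0 ≤ t → t ≤ N → ∀ z i, |F t z i| ≤ B) →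
      ∀ (a b : ℝ) i, 0 ≤ a → a ≤ b → b ≤ N → |x b i - x a i| ≤ B * (b - a) := by
    intro N B hB a b i ha hab hbN
    have h1 : Tendsto (fun k => |eulerPath F x₀ (s k) b i - eulerPath F x₀ (s k) a i|) U
        (𝓝 |x b i - x a i|) := ((hx b i).sub (hx a i)).abs
    have h2 : Tendsto (fun k => B * (b - a + s k)) U (𝓝 (B * (b - a))) := by
      simpa using (tendsto_const_nhds.add hs0).const_mul B
    exact le_of_tendsto_of_tendsto' h1 h2 fun k => eulerPath_lipschitz (hs_pos k)
      (fun r hr hrt z => hB r hr (hrt.trans hbN) z i) ha hab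
  have hlip' : ∀ (N : ℕ) (B : ℝ), (∀ t : ℝ, 0 ≤ t → t ≤ N → ∀ z i, |F t z i| ≤ B) →
      ∀ (a b : ℝ) i, 0 ≤ a → a ≤ N → 0 ≤ b → b ≤ N → |x b i - x a i| ≤ B * |b - a| := by
    intro N B hB a b i ha haN hb hbN
    rcases le_total a b with hab | hab
    · rw [abs_of_nonneg (sub_nonneg.2 hab)]
      exact hlip N B hB a b i ha hab hbN
    · rw [abs_sub_comm, abs_sub_comm b, abs_of_nonneg (sub_nonneg.2 hab)]
      exact hlip N B hB b a i hb hab haN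
  refine ⟨x, ?_, ?_, ?_⟩
  · funext i
    refine tendsto_nhds_unique (hx 0 i) ?_
    simp only [eulerPath_of_nonpos (hs_pos _) le_rfl]
    exact tendsto_const_nhds
  · intro t ht
    refine continuousWithinAt_pi.2 fun i => ?_
    obtain ⟨N, hN⟩ := exists_nat_gt t
    obtain ⟨B, hB⟩ := hF N
    have h1 : Tendsto (fun r => B * |r - t|) (𝓝[Ici 0] t) (𝓝 0) := by
      have : ContinuousAt (fun r => B * |r - t|) t := by fun_prop
      simpa using this.tendsto.mono_left nhdsWithin_le_nhds
    refine tendsto_iff_dist_tendsto_zero.2 (squeeze_zero'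
      (Eventually.of_forall fun _ => dist_nonneg) ?_ h1)
    filter_upwards [self_mem_nhdsWithin, mem_nhdsWithin_of_mem_nhds (Iio_mem_nhds hN)] with r hr hrN
    rw [Real.dist_eq]
    exact hlip' N B hB t r i ht hN.le hr (le_of_lt hrN)
  · intro t ht i hc
    set v := F t (x t) i with hv
    have key : ∀ ε > 0, ∃ r > 0, ∀ a b, t - r < a → a ≤ b → b < t + r →
        |x b i - x a i - (b - a) * v| ≤ ε * (b - a) := by
      intro ε hε
      obtain ⟨δ, hδ, hδF⟩ := Metric.continuousAt_iff.1 hc ε hε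
      obtain ⟨N, hN⟩ := exists_nat_gt (t + 1)
      obtain ⟨B, hB⟩ := hF N
      have hB0 : 0 ≤ B := (abs_nonneg _).trans (hB 0 le_rfl (by positivity) x₀ i)
      -- With steps below `r`, the nodes in use are within `2r` of `t`, so the Euler path moves by
      -- at most `B * (3r)` between them and `t`. The other `δ / 2` is left for the convergence at
      -- time `t`.
      obtain ⟨r, hr0, hr1, hrt, hrδ, hrB⟩ : ∃ r : ℝ, 0 < r ∧ r ≤ 1 ∧ r < t ∧ 2 * r < δ ∧
          B * (3 * r) < δ / 2 := by
        refine ⟨min (min 1 (t / 2)) (min (δ / 4) (δ / (12 * (B + 1)))), by positivity,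
          (min_le_left _ _).trans (min_le_left _ _), ?_, ?_, ?_⟩
        · have := (min_le_left (min 1 (t / 2)) (min (δ / 4) (δ / (12 * (B + 1))))).trans
            (min_le_right _ _)
          linarith
        · have := (min_le_right (min 1 (t / 2)) (min (δ / 4) (δ / (12 * (B + 1))))).trans
            (min_le_left _ _)
          linarith
        · have := (min_le_right (min 1 (t / 2)) (min (δ / 4) (δ / (12 * (B + 1))))).trans
            (min_le_right _ _)
          set q := min (min 1 (t / 2)) (min (δ / 4) (δ / (12 * (B + 1)))) with hq
          have hq0 : 0 < q := by rw [hq]; positivity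
          rw [le_div_iff₀ (by positivity)] at this
          nlinarith
      refine ⟨r, hr0, fun a b ha hab hb => ?_⟩
      have h1 : Tendsto (fun k => |eulerPath F x₀ (s k) b i - eulerPath F x₀ (s k) a i -
          (⌊b / s k⌋₊ * s k - ⌊a / s k⌋₊ * s k) * v|) U (𝓝 |x b i - x a i - (b - a) * v|) :=
        (((hx b i).sub (hx a i)).sub (((tendsto_floor_div_mul hs_pos hs0 (by linarith)).sub
          (tendsto_floor_div_mul hs_pos hs0 (by linarith))).mul_const v)).abs
      have h2 : Tendsto (fun k => ε * (⌊b / s k⌋₊ * s k - ⌊a / s k⌋₊ * s k)) U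
          (𝓝 (ε * (b - a))) :=
        ((tendsto_floor_div_mul hs_pos hs0 (by linarith)).sub
          (tendsto_floor_div_mul hs_pos hs0 (by linarith))).const_mul ε
      refine le_of_tendsto_of_tendsto h1 h2 ?_
      -- Convergence at the single time `t` is enough; the Lipschitz bound carries it to the
      -- neighbouring nodes.
      have h3 : ∀ᶠ k in (U : Filter ℕ), ∀ j, |eulerPath F x₀ (s k) t j - x t j| < δ / 2 := by
        refine eventually_all.2 fun j => ?_
        have := (Metric.tendsto_nhds.1 (hx t j)) (δ / 2) (by positivity)
        simpa only [Real.dist_eq] using this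
      have h4 : ∀ᶠ k in (U : Filter ℕ), s k < r := hs0.eventually_lt_const hr0
      filter_upwards [h3, h4] with k hk hkr
      have hsk := hs_pos k
      refine eulerPath_increment hsk (by linarith) hab fun p hpa hpb => ?_
      have hp0 : (0 : ℝ) ≤ p * s k := by positivity
      have hd1 : |(p : ℝ) * s k - t| < 2 * r := by rw [abs_lt]; constructor <;> linarith
      have hd2 : ∀ j, |eulerPath F x₀ (s k) (p * s k) j - eulerPath F x₀ (s k) t j| ≤
          B * (3 * r) := by
        intro j
        rcases le_total ((p : ℝ) * s k) t with hpt | hpt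
        · rw [abs_sub_comm]
          refine (eulerPath_lipschitz hsk (B := B)
            (fun q hq hqt z => hB q hq (by linarith) z j) hp0 hpt).trans ?_
          gcongr
          linarith
        · refine (eulerPath_lipschitz hsk (B := B)
            (fun q hq hqt z => hB q hq (by linarith) z j) ht.le hpt).trans ?_
          gcongr
          linarith
      have hd3 : dist ((p : ℝ) * s k, eulerPath F x₀ (s k) (p * s k)) (t, x t) < δ := by
        rw [Prod.dist_eq, max_lt_iff]
        refine ⟨by rw [Real.dist_eq]; linarith, (dist_pi_lt_iff hδ).2 fun j => ?_⟩
        rw [Real.dist_eq]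
        have := abs_sub_le (eulerPath F x₀ (s k) (p * s k) j) (eulerPath F x₀ (s k) t j) (x t j)
        linarith [hd2 j, hk j]
      have := hδF hd3
      rw [Real.dist_eq] at this
      exact this.le
    rw [hasDerivAt_iff_isLittleO, Asymptotics.isLittleO_iff]
    intro ε hε
    obtain ⟨r, hr, hkey⟩ := key ε hε
    filter_upwards [Ioo_mem_nhds (show t - r < t by linarith) (show t < t + r by linarith)]
      with q hq
    rw [Real.norm_eq_abs, Real.norm_eq_abs, smul_eq_mul]
    rcases le_total t q with htq | htq
    · rw [abs_of_nonneg (sub_nonneg.2 htq)]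
      exact hkey t q (by linarith) htq hq.2
    · have := hkey q t hq.1 htq (by linarith)
      rw [abs_sub_comm q t, abs_of_nonneg (sub_nonneg.2 htq), ← abs_neg]
      convert this using 2
      ring

/-- Continuation inside a tube: if `F` is bounded on the relatively open increasing sets `K N` over
`[0, N]` and every solution up to time `T` that stays in the tube ends in `K ⌈T⌉`, then there is a global solution. -/
theorem exists_solution_of_tube {ι : Type*} [Fintype ι] (F : ℝ → (ι → ℝ) → ι → ℝ) (x₀ : ι → ℝ)
    (K : ℕ → Set (ℝ × (ι → ℝ))) (hKmono : Monotone K)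
    (hKopen : ∀ N t z, 0 ≤ t → (t, z) ∈ K N → ∀ᶠ p in 𝓝 (t, z), 0 ≤ p.1 → p ∈ K N)
    (hF : ∀ N : ℕ, ∃ B : ℝ, ∀ (t : ℝ) z, 0 ≤ t → t ≤ N → (t, z) ∈ K N → ∀ i, |F t z i| ≤ B)
    (h0 : (0, x₀) ∈ K 0)
    (hK : ∀ T, 0 < T → ∀ y : ℝ → ι → ℝ, y 0 = x₀ → ContinuousOn y (Icc 0 T) →
      (∀ t ∈ Ico 0 T, (t, y t) ∈ K ⌈t⌉₊) →
      (∀ t ∈ Ioo 0 T, ∀ i, ContinuousAt (fun p : ℝ × (ι → ℝ) => F p.1 p.2 i) (t, y t) →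
        HasDerivAt (fun s => y s i) (F t (y t) i) t) → (T, y T) ∈ K ⌈T⌉₊) :
    ∃ y : ℝ → ι → ℝ, y 0 = x₀ ∧ ContinuousOn y (Ici 0) ∧ (∀ t, 0 ≤ t → (t, y t) ∈ K ⌈t⌉₊) ∧
      ∀ t, 0 < t → ∀ i, ContinuousAt (fun p : ℝ × (ι → ℝ) => F p.1 p.2 i) (t, y t) →
        HasDerivAt (fun s => y s i) (F t (y t) i) t := by
  classical
  -- Outside the tube the field is cut off to zero, which makes it bounded on strips; the jump at
  -- the boundary is harmless because the solution will not get there.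
  set G : ℝ → (ι → ℝ) → ι → ℝ := fun t z => if (t, z) ∈ K ⌈t⌉₊ then F t z else 0 with hG
  obtain ⟨y, hy0, hyc, hyd⟩ := exists_solution G x₀ (by
    intro N
    obtain ⟨B, hB⟩ := hF N
    refine ⟨max B 0, fun t ht htN z i => ?_⟩
    simp only [hG]
    split_ifs with h
    · exact (hB t z ht htN (hKmono (Nat.ceil_le.2 htN) h) i).trans (le_max_left _ _)
    · simp)
  have hGF : ∀ t, 0 < t → (t, y t) ∈ K ⌈t⌉₊ → ∀ i,
      ContinuousAt (fun p : ℝ × (ι → ℝ) => F p.1 p.2 i) (t, y t) →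
        HasDerivAt (fun s => y s i) (F t (y t) i) t := by
    intro t ht hmem i hc
    -- Near `t` the ceiling can only jump upwards, so neighbouring times see a tube at least as
    -- large as `K ⌈t⌉₊`.
    have hceil : ((⌈t⌉₊ - 1 : ℕ) : ℝ) < t := by
      have h1 := Nat.ceil_lt_add_one ht.le
      have h2 : 1 ≤ ⌈t⌉₊ := Nat.one_le_ceil_iff.2 ht
      push_cast [h2]
      linarith
    have hloc : (fun p : ℝ × (ι → ℝ) => F p.1 p.2 i) =ᶠ[𝓝 (t, y t)]
        fun p => G p.1 p.2 i := by
      have e1 : ∀ᶠ p : ℝ × (ι → ℝ) in 𝓝 (t, y t), 0 < p.1 :=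
        continuousAt_fst.eventually (lt_mem_nhds ht)
      have e2 : ∀ᶠ p : ℝ × (ι → ℝ) in 𝓝 (t, y t), ((⌈t⌉₊ - 1 : ℕ) : ℝ) < p.1 :=
        continuousAt_fst.eventually (lt_mem_nhds hceil)
      filter_upwards [e1, e2, hKopen _ _ _ ht.le hmem] with p hp1 hp2 hp3
      have h3 : ⌈t⌉₊ ≤ ⌈p.1⌉₊ := by
        have := Nat.lt_ceil.2 hp2
        omega
      have : (p.1, p.2) ∈ K ⌈p.1⌉₊ := hKmono h3 (hp3 hp1.le)
      simp only [hG, if_pos this]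
    have := hyd t ht i (hc.congr hloc)
    rwa [show F t (y t) i = G t (y t) i from hloc.self_of_nhds]
  have hall : ∀ t, 0 ≤ t → (t, y t) ∈ K ⌈t⌉₊ := by
    by_contra! hcon
    -- At the first exit time the end-point hypothesis still puts the solution in the tube, and
    -- openness keeps it there a little longer: a contradiction.
    set S : Set ℝ := {t | 0 ≤ t ∧ (t, y t) ∉ K ⌈t⌉₊} with hS
    have hSne : S.Nonempty := hcon
    have hSbdd : BddBelow S := ⟨0, fun t ht => ht.1⟩
    have hT0 : 0 ≤ sInf S := le_csInf hSne fun t ht => ht.1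
    have hbefore : ∀ t, 0 ≤ t → t < sInf S → (t, y t) ∈ K ⌈t⌉₊ := by
      intro t ht hlt
      by_contra h
      exact absurd (csInf_le hSbdd ⟨ht, h⟩) (not_le.2 hlt)
    have hmem : (sInf S, y (sInf S)) ∈ K ⌈sInf S⌉₊ := by
      rcases hT0.eq_or_lt with h | h
      · rw [← h, hy0]
        simpa using h0
      · exact hK _ h y hy0 (hyc.mono Icc_subset_Ici_self)
          (fun t ht => hbefore t ht.1 ht.2) fun t ht i hc =>
          hGF t ht.1 (hbefore t ht.1.le ht.2) i hc
    have hcw : Tendsto (fun t => (t, y t)) (𝓝[Ici 0] (sInf S)) (𝓝 (sInf S, y (sInf S))) :=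
      (continuousWithinAt_id.prodMk (hyc _ hT0) :)
    have hev : ∀ᶠ t in 𝓝[Ici 0] (sInf S), (t, y t) ∈ K ⌈sInf S⌉₊ := by
      filter_upwards [hcw.eventually (hKopen _ _ _ hT0 hmem), self_mem_nhdsWithin] with t h1 h2
      exact h1 h2
    obtain ⟨δ, hδ, hδK⟩ := Metric.mem_nhdsWithin_iff.1 hev
    obtain ⟨t, htS, htlt⟩ := exists_lt_of_csInf_lt hSne (show sInf S < sInf S + δ by linarith)
    have hle := csInf_le hSbdd htS
    refine htS.2 (hKmono (Nat.ceil_mono hle) (hδK ⟨?_, htS.1⟩))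
    rw [Metric.mem_ball, Real.dist_eq, abs_of_nonneg (by linarith)]
    linarith
  exact ⟨y, hy0, hyc, hall, fun t ht i hc => hGF t ht (hall t ht.le) i hc⟩

end QSMC

namespace QSMC

/-! ### Scalar comparison lemmas -/

/-- A continuous function that starts negative and decreases while it is in `(-κ, 0)`, off a
locally finite set of times, remains negative. -/
theorem neg_of_nonincreasing_near_zero {w : ℝ → ℝ} {T κ : ℝ} {D : Set ℝ} (hκ : 0 < κ)
    (hw : ContinuousOn w (Ico 0 T)) (h0 : w 0 < 0) (hD : (D ∩ Ioo 0 T).Finite)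
    (h : ∀ t ∈ Ioo 0 T, t ∉ D → -κ < w t → w t < 0 → ∃ w' ≤ 0, HasDerivAt w w' t) :
    ∀ t ∈ Ico 0 T, w t < 0 := by
  intro b hb
  by_contra! hwb
  have hcb : ContinuousOn w (Icc 0 b) := hw.mono (Icc_subset_Ico_right hb.2)
  obtain ⟨t, ⟨htb, hwt⟩, htmin⟩ := IsCompact.exists_isLeast
    (isCompact_Icc.of_isClosed_subset (hcb.preimage_isClosed_of_isClosed isClosed_Icc
      (isClosed_Ici (a := 0))) inter_subset_left) ⟨b, ⟨hb.1, le_rfl⟩, hwb⟩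
  have hwt : 0 ≤ w t := hwt
  have hneg : ∀ s, 0 ≤ s → s < t → w s < 0 := by
    intro s hs hst
    by_contra! hws
    exact absurd (htmin ⟨⟨hs, hst.le.trans htb.2⟩, hws⟩) (not_le.2 hst)
  have ht0 : 0 < t := by
    rcases htb.1.eq_or_lt with h | h
    · rw [← h] at hwt
      linarith
    · exact h
  have htT : t < T := htb.2.trans_lt hb.2
  -- The first zero `t` may itself be exceptional; only a left neighbourhood free of `D` is needed,
  -- and there `w` cannot rise to zero.
  have hfin : ((D ∩ Ioo 0 T) \ {t}).Finite := hD.subset sdiff_subset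
  have e1 : ∀ᶠ s in 𝓝[<] t, s ∉ D ∩ Ioo 0 T := by
    have := hfin.isClosed.isOpen_compl.mem_nhds (x := t) (by simp)
    filter_upwards [mem_nhdsWithin_of_mem_nhds this, self_mem_nhdsWithin] with s hs hst hsD
    exact hs ⟨hsD, hst.ne⟩
  have hct : Tendsto w (𝓝[<] t) (𝓝 (w t)) :=
    (hw.continuousAt (Ico_mem_nhds ht0 htT)).tendsto.mono_left nhdsWithin_le_nhds
  have e2 : ∀ᶠ s in 𝓝[<] t, -κ < w s := hct.eventually (lt_mem_nhds (by linarith))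
  have e3 : ∀ᶠ s in 𝓝[<] t, 0 < s := mem_nhdsWithin_of_mem_nhds (lt_mem_nhds ht0)
  obtain ⟨l, hl, hsub⟩ := (mem_nhdsLT_iff_exists_Ioo_subset).1 ((e1.and e2).and e3)
  have hl : l < t := hl
  set p := (l + t) / 2 with hp
  have hpl : l < p := by rw [hp]; linarith
  have hpt : p < t := by rw [hp]; linarith
  have hp0 : 0 < p := (hsub ⟨hpl, hpt⟩).2
  have hderiv : ∀ s ∈ Ioo p t, ∃ w' ≤ 0, HasDerivAt w w' s := by
    intro s hs
    obtain ⟨⟨h1, h2⟩, h3⟩ := hsub ⟨hpl.trans hs.1, hs.2⟩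
    have hsT : s ∈ Ioo 0 T := ⟨h3, hs.2.trans htT⟩
    exact h s hsT (fun hsD => h1 ⟨hsD, hsT⟩) h2 (hneg s h3.le hs.2)
  have hanti : AntitoneOn w (Icc p t) := by
    refine antitoneOn_of_deriv_nonpos (convex_Icc _ _)
      (hw.mono fun s hs => ⟨hp0.le.trans hs.1, hs.2.trans_lt htT⟩) ?_ ?_
    · rw [interior_Icc]
      intro s hs
      obtain ⟨w', -, hw'⟩ := hderiv s hs
      exact hw'.differentiableAt.differentiableWithinAt
    · rw [interior_Icc]
      intro s hs
      obtain ⟨w', hle, hw'⟩ := hderiv s hs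
      rwa [hw'.deriv]
  have := hanti ⟨le_rfl, hpt.le⟩ ⟨hpt.le, le_rfl⟩ hpt.le
  linarith [hneg p hp0.le hpt]

/-- With the integrating factor, `(w - β/a) e^{at}` is eventually nonincreasing, so `w` exceeds
`β/a` by at most a decaying exponential. -/
theorem exp_decay_upper {w v : ℝ → ℝ} {a β β' : ℝ} (ha : 0 < a) (hβ : β / a < β')
    (hw : ∀ᶠ t in atTop, HasDerivAt w (v t - a * w t) t) (hv : ∀ᶠ t in atTop, v t ≤ β) :
    ∀ᶠ t in atTop, w t < β' := by
  obtain ⟨T, hT⟩ := eventually_atTop.1 (hw.and hv)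
  set φ : ℝ → ℝ := fun t => (w t - β / a) * Real.exp (a * t) with hφ
  have hd : ∀ t ∈ Ici T, HasDerivAt φ ((v t - β) * Real.exp (a * t)) t := by
    intro t ht
    have h1 : HasDerivAt (fun s : ℝ => Real.exp (a * s)) (Real.exp (a * t) * a) t := by
      simpa using ((hasDerivAt_id t).const_mul a).exp
    have h2 := ((hT t ht).1.sub_const (β / a)).mul h1
    refine h2.congr_deriv ?_
    field_simp
    ring
  have hanti : AntitoneOn φ (Ici T) := by
    refine antitoneOn_of_deriv_nonpos (convex_Ici _)
      (fun t ht => (hd t ht).continuousAt.continuousWithinAt)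
      (fun t ht => (hd t (interior_subset ht)).differentiableAt.differentiableWithinAt)
      fun t ht => ?_
    rw [(hd t (interior_subset ht)).deriv]
    exact mul_nonpos_of_nonpos_of_nonneg (by linarith [(hT t (interior_subset ht)).2])
      (Real.exp_pos _).le
  have hlim : Tendsto (fun t => β / a + φ T * Real.exp (-(a * t))) atTop (𝓝 (β / a)) := by
    have : Tendsto (fun t : ℝ => Real.exp (-(a * t))) atTop (𝓝 0) :=
      Real.tendsto_exp_neg_atTop_nhds_zero.comp (tendsto_id.const_mul_atTop ha)
    simpa using (this.const_mul (φ T)).const_add (β / a)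
  filter_upwards [hlim.eventually (gt_mem_nhds hβ), eventually_ge_atTop T] with t h1 h2
  have h3 := hanti (self_mem_Ici) h2 h2
  have h4 : w t = β / a + φ t * Real.exp (-(a * t)) := by
    have : Real.exp (a * t) * Real.exp (-(a * t)) = 1 := by rw [← Real.exp_add]; simp
    simp only [hφ]
    rw [mul_assoc, this]
    ring
  rw [h4]
  refine lt_of_le_of_lt ?_ h1
  gcongr

/-- Ultimate bound for the stable first order filter `w' + a w = v`. -/
theorem exp_decay_bound {w v : ℝ → ℝ} {a β β' : ℝ} (ha : 0 < a) (hβ : β / a < β')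
    (hw : ∀ᶠ t in atTop, HasDerivAt w (v t - a * w t) t) (hv : ∀ᶠ t in atTop, |v t| ≤ β) :
    ∀ᶠ t in atTop, |w t| < β' := by
  have h1 := exp_decay_upper ha hβ hw (hv.mono fun t ht => (abs_le.1 ht).2)
  have h2 := exp_decay_upper (w := fun t => -w t) (v := fun t => -v t) ha hβ
    (hw.mono fun t ht => ht.neg.congr_deriv (by ring))
    (hv.mono fun t ht => by linarith [(abs_le.1 ht).1])
  filter_upwards [h1, h2] with t h3 h4
  rw [abs_lt]
  constructor <;> linarith

/-! ### Cascades of first order filters -/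

/-- The sequence `(S + a)^k E`, where `S` is the shift of sequences of functions. -/
def cascade (a : ℝ) (E : ℕ → ℝ → ℝ) : ℕ → ℕ → ℝ → ℝ
  | 0 => E
  | k + 1 => fun j t => cascade a E k (j + 1) t + a * cascade a E k j t

/-- At a fixed time the shift is a linear endomorphism of real sequences that commutes with scalars,
so the binomial theorem applies. -/
theorem cascade_eq_sum (a : ℝ) (E : ℕ → ℝ → ℝ) (k j : ℕ) (t : ℝ) :
    cascade a E k j t =
      ∑ l ∈ Finset.range (k + 1), (k.choose l : ℝ) * a ^ (k - l) * E (j + l) t := by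
  let S : Module.End ℝ (ℕ → ℝ) := LinearMap.funLeft ℝ ℝ Nat.succ
  have hS : ∀ l (G : ℕ → ℝ) j, (S ^ l) G j = G (j + l) := by
    intro l
    induction l with
    | zero => intro G j; simp
    | succ l ih =>
      intro G j
      rw [pow_succ, Module.End.mul_apply, ih]
      simp [S, LinearMap.funLeft_apply, add_assoc]
  have h1 : ∀ k j, cascade a E k j t = ((S + algebraMap ℝ _ a) ^ k) (fun l => E l t) j := by
    intro k
    induction k with
    | zero => intro j; simp [cascade]
    | succ k ih =>
      intro j
      rw [pow_succ', Module.End.mul_apply]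
      simp only [cascade, ih, LinearMap.add_apply, Pi.add_apply, Module.algebraMap_end_apply,
        Pi.smul_apply, smul_eq_mul]
      rfl
  rw [h1, (Algebra.commute_algebraMap_right a S).add_pow]
  rw [LinearMap.sum_apply, Finset.sum_apply]
  refine Finset.sum_congr rfl fun l _ => ?_
  rw [← map_pow, ← map_natCast (algebraMap ℝ (Module.End ℝ (ℕ → ℝ))), mul_assoc, ← map_mul,
    Module.End.mul_apply, hS, Module.algebraMap_end_apply]
  simp only [Pi.smul_apply, smul_eq_mul]
  ring

theorem hasDerivAt_cascade {a t : ℝ} {E : ℕ → ℝ → ℝ} {m : ℕ}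
    (hE : ∀ j < m, HasDerivAt (E j) (E (j + 1) t) t) (k : ℕ) :
    ∀ j, k + j < m → HasDerivAt (cascade a E k j) (cascade a E k (j + 1) t) t := by
  induction k with
  | zero => intro j hj; exact hE j (by omega)
  | succ k ih =>
    intro j hj
    exact (ih (j + 1) (by omega)).add ((ih j (by omega)).const_mul a)

/-- If the chain of derivatives `E 0, …, E m` satisfies `(d/dt + a)^m (E 0) = v`, an ultimate
bound on `v` gives ultimate bounds on all members of the chain. -/
theorem eventually_abs_lt_of_cascade {a L : ℝ} (ha : 0 < a) {E : ℕ → ℝ → ℝ} {m : ℕ}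
    (hE : ∀ᶠ t in atTop, ∀ j < m, HasDerivAt (E j) (E (j + 1) t) t)
    (hL : ∀ δ > L, ∀ᶠ t in atTop, |cascade a E m 0 t| < δ) {δ : ℝ} (hδ : L < δ) {j : ℕ}
    (hj : j ≤ m) : ∀ᶠ t in atTop, |E j t| < (2 * a) ^ j * (δ / a ^ m) := by
  -- Filters are removed one at a time, each with gain `1/a`. Each needs a strict margin, taken as
  -- half of `δ - L`; hence the quantification over all `δ > L`.
  have h1 : ∀ q ≤ m, ∀ δ > L, ∀ᶠ t in atTop, |cascade a E (m - q) 0 t| < δ / a ^ q := by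
    intro q
    induction q with
    | zero => intro _ δ hδ; simpa using hL δ hδ
    | succ q ih =>
      intro hq δ hδ
      have h2 := ih (by omega) ((L + δ) / 2) (by linarith)
      refine exp_decay_bound (v := cascade a E (m - q) 0) (β := (L + δ) / 2 / a ^ q) ha ?_ ?_
        (h2.mono fun t ht => ht.le)
      · rw [div_div, ← pow_succ]
        gcongr
        linarith
      · filter_upwards [hE] with t ht
        refine (hasDerivAt_cascade (a := a) ht (m - (q + 1)) 0 (by omega)).congr_deriv ?_
        have : m - q = m - (q + 1) + 1 := by omega
        rw [this]
        simp [cascade]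
  -- Raising `j` uses `S = (S + a) - a`. The two terms have equal bounds, whence the factor `2a`;
  -- the first one involves `k + 1`, so `k` stays general.
  have h2 : ∀ j k, k + j ≤ m →
      ∀ᶠ t in atTop, |cascade a E k j t| < (2 * a) ^ j * (δ / a ^ (m - k)) := by
    intro j
    induction j with
    | zero =>
      intro k hk
      have := h1 (m - k) (by omega) δ hδ
      rw [show m - (m - k) = k by omega] at this
      simpa using this
    | succ j ih =>
      intro k hk
      filter_upwards [ih k (by omega), ih (k + 1) (by omega)] with t h3 h4
      have h5 : cascade a E k (j + 1) t = cascade a E (k + 1) j t - a * cascade a E k j t := by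
        simp [cascade]
      have h6 : a * |cascade a E k j t| < a * ((2 * a) ^ j * (δ / a ^ (m - k))) := by gcongr
      have h7 := abs_sub (cascade a E (k + 1) j t) (a * cascade a E k j t)
      rw [abs_mul, abs_of_pos ha] at h7
      rw [h5]
      have h8 : (2 * a) ^ (j + 1) * (δ / a ^ (m - k)) =
          (2 * a) ^ j * (δ / a ^ (m - (k + 1))) + a * ((2 * a) ^ j * (δ / a ^ (m - k))) := by
        rw [show m - k = m - (k + 1) + 1 by omega]
        field_simp
        ring
      linarith
  simpa [cascade] using h2 j 0 (by omega)

end QSMC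

namespace QSMC

/-! ### Closed-loop trajectories -/

theorem hasDerivAt_iteratedDerivWithin_Ici {xdes : ℝ → ℝ} (hx : ContDiffOn ℝ ∞ xdes (Ici 0))
    (j : ℕ) {t : ℝ} (ht : 0 < t) :
    HasDerivAt (iteratedDerivWithin j xdes (Ici 0)) (iteratedDerivWithin (j + 1) xdes (Ici 0) t)
      t := by
  have h1 := hx.differentiableOn_iteratedDerivWithin (m := j) (mod_cast WithTop.coe_lt_top j)
    (uniqueDiffOn_Ici 0) t ht.le
  rw [iteratedDerivWithin_succ]
  exact h1.hasDerivWithinAt.hasDerivAt (Ici_mem_nhds ht)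

theorem continuousOn_iteratedDerivWithin_Ici {xdes : ℝ → ℝ} (hx : ContDiffOn ℝ ∞ xdes (Ici 0))
    (j : ℕ) : ContinuousOn (iteratedDerivWithin j xdes (Ici 0)) (Ici 0) :=
  hx.continuousOn_iteratedDerivWithin (m := j) (mod_cast le_top) (uniqueDiffOn_Ici 0)

section Trajectories

variable {m : ℕ} {f g : (Fin (m + 1) → ℝ) → ℝ} {d xdes : ℝ → ℝ} {c : Fin m → ℝ}
  {ρ₀ ρinf μ : ℝ} {x₀ : Fin (m + 1) → ℝ}

theorem continuousOn_err (hx : ContDiffOn ℝ ∞ xdes (Ici 0)) (i : Fin (m + 1)) :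
    ContinuousOn (fun p : ℝ × (Fin (m + 1) → ℝ) => err xdes p.1 p.2 i) (Ici 0 ×ˢ univ) := by
  have h1 : ContinuousOn (fun p : ℝ × (Fin (m + 1) → ℝ) =>
      iteratedDerivWithin (i : ℕ) xdes (Ici 0) p.1) (Ici 0 ×ˢ univ) :=
    (continuousOn_iteratedDerivWithin_Ici hx i).comp continuousOn_fst fun p hp => hp.1
  have h2 : Continuous fun p : ℝ × (Fin (m + 1) → ℝ) => p.2 i := by fun_prop
  exact h2.continuousOn.sub h1

theorem continuousOn_sigma (hx : ContDiffOn ℝ ∞ xdes (Ici 0)) :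
    ContinuousOn (fun p : ℝ × (Fin (m + 1) → ℝ) => sigma c xdes p.1 p.2) (Ici 0 ×ˢ univ) := by
  unfold sigma
  exact (continuousOn_finsetSum _ fun j _ => (continuousOn_err hx _).const_mul _).add
    (continuousOn_err hx _)

theorem continuousOn_graph {x : ℝ → Fin (m + 1) → ℝ} {J : Set ℝ} (hJ : J ⊆ Ici 0)
    (hxc : ContinuousOn x J) {φ : ℝ × (Fin (m + 1) → ℝ) → ℝ}
    (hφ : ContinuousOn φ (Ici 0 ×ˢ univ)) : ContinuousOn (fun t => φ (t, x t)) J :=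
  hφ.comp (continuousOn_id.prodMk hxc) fun _ ht => ⟨hJ ht, mem_univ _⟩

/-- The part of the derivative of the sliding variable that does not depend on the input. -/
noncomputable def drift (f : (Fin (m + 1) → ℝ) → ℝ) (d : ℝ → ℝ) (c : Fin m → ℝ) (xdes : ℝ → ℝ)
    (t : ℝ) (z : Fin (m + 1) → ℝ) : ℝ :=
  f z + d t + ∑ j : Fin m, c j * err xdes t z j.succ - iteratedDerivWithin (m + 1) xdes (Ici 0) t

theorem hasDerivAt_err (hx : ContDiffOn ℝ ∞ xdes (Ici 0)) {x : ℝ → Fin (m + 1) → ℝ} {t v : ℝ}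
    (ht : 0 < t) {i : Fin (m + 1)} (hv : HasDerivAt (fun s => x s i) v t) :
    HasDerivAt (fun s => err xdes s (x s) i)
      (v - iteratedDerivWithin (i + 1 : ℕ) xdes (Ici 0) t) t :=
  hv.sub (hasDerivAt_iteratedDerivWithin_Ici hx i ht)

theorem IsTrajectoryOn.mono {u : ℝ → (Fin (m + 1) → ℝ) → ℝ} {J J' : Set ℝ}
    {x : ℝ → Fin (m + 1) → ℝ} (h : IsTrajectoryOn f g d u J x) (hJ : J' ⊆ J) :
    IsTrajectoryOn f g d u J' x :=
  ⟨h.continuousOn.mono hJ, fun t ht => h.chain t (interior_mono hJ ht),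
    fun t ht => h.last t (interior_mono hJ ht)⟩

theorem IsTrajectoryOn.hasDerivAt_err_castSucc {u : ℝ → (Fin (m + 1) → ℝ) → ℝ} {J : Set ℝ}
    {x : ℝ → Fin (m + 1) → ℝ} (h : IsTrajectoryOn f g d u J x)
    (hx : ContDiffOn ℝ ∞ xdes (Ici 0)) {t : ℝ} (htJ : t ∈ interior J) (ht : 0 < t) (j : Fin m) :
    HasDerivAt (fun s => err xdes s (x s) j.castSucc) (err xdes t (x t) j.succ) t :=
  hasDerivAt_err hx ht (h.chain t htJ j)

theorem IsTrajectoryOn.hasDerivAt_sigma {u : ℝ → (Fin (m + 1) → ℝ) → ℝ} {J : Set ℝ}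
    {x : ℝ → Fin (m + 1) → ℝ} (h : IsTrajectoryOn f g d u J x)
    (hx : ContDiffOn ℝ ∞ xdes (Ici 0)) {t : ℝ} (htJ : t ∈ interior J) (ht : 0 < t)
    (hdt : ContinuousAt d t) :
    HasDerivAt (fun s => sigma c xdes s (x s))
      (drift f d c xdes t (x t) + g (x t) * u t (x t)) t := by
  have h1 : HasDerivAt (fun s => ∑ j : Fin m, c j * err xdes s (x s) j.castSucc)
      (∑ j : Fin m, c j * err xdes t (x t) j.succ) t :=
    HasDerivAt.fun_sum fun j _ => (h.hasDerivAt_err_castSucc hx htJ ht j).const_mul (c j)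
  have h2 := hasDerivAt_err hx ht (h.last t htJ hdt)
  refine (h1.add h2).congr_deriv ?_
  simp only [drift, Fin.val_last]
  ring

/-- Only `|g|` survives: the direction of the input no longer depends on the sign of the gain, and
no sign discontinuity remains. -/
theorem mul_control (t : ℝ) (z : Fin (m + 1) → ℝ) :
    g z * control g c xdes ρ₀ ρinf μ t z =
      -(|g z| * Real.tan (Real.pi * sigma c xdes t z / (2 * rho ρ₀ ρinf μ t))) := by
  have : g z * Real.sign (g z) = |g z| := by
    rcases lt_trichotomy (g z) 0 with h | h | h
    · rw [Real.sign_of_neg h, abs_of_neg h]; ring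
    · simp [h]
    · rw [Real.sign_of_pos h, abs_of_pos h]; ring
  rw [control, ← this]
  ring

theorem lt_rho (hρ₀ : 0 < ρ₀) (t : ℝ) : ρinf < rho ρ₀ ρinf μ t := by
  have := mul_pos hρ₀ (Real.exp_pos (-μ * t))
  rw [rho]
  linarith

theorem rho_le (hρ₀ : 0 < ρ₀) (hμ : 0 < μ) {t : ℝ} (ht : 0 ≤ t) :
    rho ρ₀ ρinf μ t ≤ ρ₀ + ρinf := by
  have h1 : Real.exp (-μ * t) ≤ 1 := Real.exp_le_one_iff.2 (by nlinarith)
  have h2 := mul_le_of_le_one_right hρ₀.le h1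
  rw [rho]
  linarith

theorem hasDerivAt_rho (t : ℝ) :
    HasDerivAt (rho ρ₀ ρinf μ) (-(μ * (ρ₀ * Real.exp (-μ * t)))) t := by
  have h1 : HasDerivAt (fun s : ℝ => Real.exp (-μ * s)) (Real.exp (-μ * t) * -μ) t := by
    simpa using ((hasDerivAt_id t).const_mul (-μ)).exp
  exact ((h1.const_mul ρ₀).add_const ρinf).congr_deriv (by ring)

theorem continuous_rho : Continuous (rho ρ₀ ρinf μ) := by
  unfold rho
  fun_prop

theorem mul_tan_of_sign {s y : ℝ} (hs : s = 1 ∨ s = -1) : s * Real.tan y = Real.tan (s * y) := by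
  rcases hs with rfl | rfl <;> simp

/-- If the drift is at most `H` and the input dominates it as soon as `|σ| ≥ θ' ρ`, then the
set `|σ| < θ ρ` is invariant for `θ' < θ < 1`. -/
theorem IsTrajectoryOn.abs_sigma_lt_of_drift_le {T gl H θ θ' : ℝ} {x : ℝ → Fin (m + 1) → ℝ}
    (h : IsTrajectoryOn f g d (control g c xdes ρ₀ ρinf μ) (Ico 0 T) x)
    (hx : ContDiffOn ℝ ∞ xdes (Ici 0)) (hd : PiecewiseContinuous d)
    (hg : ∀ z, gl ≤ |g z|) (hρ₀ : 0 < ρ₀) (hρinf : 0 < ρinf) (hμ : 0 < μ)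
    (hθ' : 0 < θ') (hθθ' : θ' < θ) (hθ : θ < 1)
    (hH : ∀ t ∈ Ioo 0 T, |drift f d c xdes t (x t)| ≤ H)
    (htan : H + μ * ρ₀ ≤ gl * Real.tan (Real.pi * θ' / 2))
    (h0 : |sigma c xdes 0 (x 0)| < θ * rho ρ₀ ρinf μ 0) :
    ∀ t ∈ Ico 0 T, |sigma c xdes t (x t)| < θ * rho ρ₀ ρinf μ t := by
  have hπ := Real.pi_pos
  have key : ∀ s : ℝ, s = 1 ∨ s = -1 →
      ∀ t ∈ Ico 0 T, s * sigma c xdes t (x t) - θ * rho ρ₀ ρinf μ t < 0 := by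
    intro s hs
    have hs1 : |s| = 1 := by rcases hs with rfl | rfl <;> simp
    have hss : s * s = 1 := by rcases hs with rfl | rfl <;> norm_num
    -- As `ρ > ρ_∞`, being within this `κ` of the wall `θρ` forces `s σ > θ'ρ`, the region where the
    -- input dominates. The signs `s = ±1` treat the two walls.
    refine neg_of_nonincreasing_near_zero (κ := (θ - θ') * ρinf) (D := {t | ¬ ContinuousAt d t})
      (mul_pos (by linarith) hρinf) ?_ ?_ ?_ ?_
    · exact ((continuousOn_graph Ico_subset_Ici_self h.continuousOn
        (continuousOn_sigma hx)).const_mul s).sub (continuous_rho.continuousOn.const_mul θ)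
    · have := le_abs_self (s * sigma c xdes 0 (x 0))
      rw [abs_mul, hs1, one_mul] at this
      linarith
    · exact (hd.1 T).subset fun t ht => ⟨ht.2, ht.1⟩
    · intro t ht htD hlo hhi
      have hdt : ContinuousAt d t := not_not.1 htD
      have hρ := lt_rho (ρinf := ρinf) (μ := μ) hρ₀ t
      have hρpos : 0 < rho ρ₀ ρinf μ t := hρinf.trans hρ
      have hsig := h.hasDerivAt_sigma (c := c) hx (by rwa [interior_Ico]) ht.1 hdt
      refine ⟨_, ?_, (hsig.const_mul s).sub ((hasDerivAt_rho t).const_mul θ)⟩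
      have hlo' : θ' * rho ρ₀ ρinf μ t < s * sigma c xdes t (x t) := by
        have : (θ - θ') * ρinf ≤ (θ - θ') * rho ρ₀ ρinf μ t := by
          have : 0 ≤ θ - θ' := by linarith
          gcongr
        linarith
      have hhi' : s * sigma c xdes t (x t) < rho ρ₀ ρinf μ t := by nlinarith
      have e1 : Real.pi * θ' / 2 ≤
          s * (Real.pi * sigma c xdes t (x t) / (2 * rho ρ₀ ρinf μ t)) := by
        rw [← mul_div_assoc, div_le_div_iff₀ two_pos (by positivity)]
        nlinarith
      have e2 : s * (Real.pi * sigma c xdes t (x t) / (2 * rho ρ₀ ρinf μ t)) < Real.pi / 2 := by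
        rw [← mul_div_assoc, div_lt_div_iff₀ (by positivity) two_pos]
        nlinarith
      have e3 : 0 < Real.pi * θ' / 2 := by positivity
      have htan' := Real.strictMonoOn_tan.monotoneOn (a := Real.pi * θ' / 2)
        ⟨by linarith, by linarith⟩ ⟨by linarith, e2⟩ e1
      have htan0 : 0 < Real.tan (Real.pi * θ' / 2) :=
        Real.tan_pos_of_pos_of_lt_pi_div_two e3 (by linarith)
      have hin : gl * Real.tan (Real.pi * θ' / 2) ≤ |g (x t)| *
          Real.tan (s * (Real.pi * sigma c xdes t (x t) / (2 * rho ρ₀ ρinf μ t))) :=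
        mul_le_mul (hg _) htan' htan0.le (abs_nonneg _)
      have hdr : s * drift f d c xdes t (x t) ≤ H := by
        have := le_abs_self (s * drift f d c xdes t (x t))
        rw [abs_mul, hs1, one_mul] at this
        exact this.trans (hH t ht)
      rw [← mul_tan_of_sign hs] at hin
      have hexp : θ * (μ * (ρ₀ * Real.exp (-μ * t))) ≤ μ * ρ₀ := by
        have h1 : Real.exp (-μ * t) ≤ 1 := Real.exp_le_one_iff.2 (by nlinarith [ht.1])
        have h2 := mul_le_of_le_one_right hρ₀.le h1
        have h3 : 0 ≤ μ * (ρ₀ * Real.exp (-μ * t)) := by positivity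
        have h4 := mul_le_of_le_one_left h3 hθ.le
        have h5 := mul_le_mul_of_nonneg_left h2 hμ.le
        linarith
      rw [mul_control]
      linarith
  intro t ht
  have h1 := key 1 (Or.inl rfl) t ht
  have h2 := key (-1) (Or.inr rfl) t ht
  rw [abs_lt]
  constructor <;> linarith

/-- The tangent is unbounded below `π/2`, so any demand `A` is met at a relative level `θ < 1`. The
`+ 1` in the maximum makes `θ` strictly exceed the initial ratio `q`. -/
theorem exists_tan_ge {q A gl : ℝ} (hq0 : 0 ≤ q) (hq : q < 1) (hgl : 0 < gl) :
    ∃ θ, q < θ ∧ θ < 1 ∧ A ≤ gl * Real.tan (Real.pi * θ / 2) := by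
  have hπ := Real.pi_pos
  set B := max (A / gl) (Real.tan (Real.pi * q / 2) + 1) with hB
  have h1 : Real.pi * (2 / Real.pi * Real.arctan B) / 2 = Real.arctan B := by
    field_simp
  refine ⟨2 / Real.pi * Real.arctan B, ?_, ?_, ?_⟩
  · have h2 : Real.arctan (Real.tan (Real.pi * q / 2)) = Real.pi * q / 2 :=
      Real.arctan_tan (by nlinarith) (by nlinarith)
    have h3 : Real.arctan (Real.tan (Real.pi * q / 2)) < Real.arctan B :=
      Real.arctan_strictMono ((lt_add_one _).trans_le (le_max_right _ _))
    rw [h2] at h3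
    have : 2 / Real.pi * (Real.pi * q / 2) < 2 / Real.pi * Real.arctan B := by gcongr
    convert this using 1
    field_simp
  · have := Real.arctan_lt_pi_div_two B
    rw [div_mul_eq_mul_div, div_lt_one hπ]
    linarith
  · rw [h1, Real.tan_arctan, ← div_le_iff₀' hgl]
    exact le_max_left _ _

/-- The disturbance may jump and is bounded by hypothesis; the rest is continuous on a compact set.
-/
theorem exists_drift_bound (hf : Continuous f) (hx : ContDiffOn ℝ ∞ xdes (Ici 0))
    {db : ℝ} (hdb : ∀ t, 0 ≤ t → |d t| < db) (N R : ℝ) :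
    ∃ H, ∀ t ∈ Icc 0 N, ∀ z : Fin (m + 1) → ℝ, ‖z‖ ≤ R → |drift f d c xdes t z| ≤ H := by
  have hc : ContinuousOn (fun p : ℝ × (Fin (m + 1) → ℝ) =>
      f p.2 + ∑ j : Fin m, c j * err xdes p.1 p.2 j.succ -
        iteratedDerivWithin (m + 1) xdes (Ici 0) p.1) (Ici 0 ×ˢ univ) := by
    refine ((hf.comp continuous_snd).continuousOn.add (continuousOn_finsetSum _ fun j _ =>
      (continuousOn_err hx _).const_mul _)).sub ?_
    exact (continuousOn_iteratedDerivWithin_Ici hx _).comp continuousOn_fst fun p hp => hp.1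
  obtain ⟨H, hH⟩ := (isCompact_Icc.prod (isCompact_closedBall (0 : Fin (m + 1) → ℝ) R)
    ).exists_bound_of_continuousOn
      (hc.mono fun p (hp : p ∈ Icc 0 N ×ˢ _) => ⟨hp.1.1, mem_univ _⟩)
  refine ⟨H + db, fun t ht z hz => ?_⟩
  have h1 := hH (t, z) ⟨ht, by simpa using hz⟩
  rw [Real.norm_eq_abs] at h1
  have h2 := hdb t ht.1
  rw [abs_le] at h1 ⊢
  rw [abs_lt] at h2
  simp only [drift]
  constructor <;> linarith [h1.1, h1.2, h2.1, h2.2]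

/-- The reaching law: the sliding variable stays inside the funnel. -/
theorem IsTrajectoryOn.abs_sigma_lt_rho {T gl db : ℝ} {x : ℝ → Fin (m + 1) → ℝ}
    (h : IsTrajectoryOn f g d (control g c xdes ρ₀ ρinf μ) (Ico 0 T) x) (hf : Continuous f)
    (hx : ContDiffOn ℝ ∞ xdes (Ici 0)) (hd : PiecewiseContinuous d)
    (hdb : ∀ t, 0 ≤ t → |d t| < db)
    (hgl : 0 < gl) (hg : ∀ z, gl ≤ |g z|) (hρ₀ : 0 < ρ₀) (hρinf : 0 < ρinf) (hμ : 0 < μ)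
    (h0 : |sigma c xdes 0 (x 0)| < rho ρ₀ ρinf μ 0) :
    ∀ t ∈ Ico 0 T, |sigma c xdes t (x t)| < rho ρ₀ ρinf μ t := by
  intro t ht
  have htT := ht.2
  -- The trajectory may a priori blow up at `T`, so compactness is used on `[0, S]` with `S < T`.
  set S := (t + T) / 2 with hS
  have hST : S < T := by rw [hS]; linarith
  have htS : t < S := by rw [hS]; linarith
  have hρ0 : 0 < rho ρ₀ ρinf μ 0 := hρinf.trans (lt_rho hρ₀ 0)
  obtain ⟨R, hR⟩ := isCompact_Icc.exists_bound_of_continuousOn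
    (h.continuousOn.mono fun r (hr : r ∈ Icc 0 S) => ⟨hr.1, hr.2.trans_lt hST⟩)
  obtain ⟨H, hH⟩ := exists_drift_bound (m := m) (c := c) hf hx hdb S R
  obtain ⟨θ', hq, hθ', htan⟩ := exists_tan_ge (A := H + μ * ρ₀) (gl := gl)
    (div_nonneg (abs_nonneg _) hρ0.le) ((div_lt_one hρ0).2 h0) hgl
  have hθ'0 : 0 < θ' := (div_nonneg (abs_nonneg _) hρ0.le).trans_lt hq
  have h1 := (h.mono (Ico_subset_Ico_right hST.le)).abs_sigma_lt_of_drift_le hx hd hg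
    hρ₀ hρinf hμ (θ := (θ' + 1) / 2) hθ'0 (by linarith) (by linarith)
    (fun r hr => hH r ⟨hr.1.le, hr.2.le⟩ _ (hR r ⟨hr.1.le, hr.2.le⟩)) htan
    (by rw [div_lt_iff₀ hρ0] at hq; nlinarith) t ⟨ht.1, htS⟩
  have hρt : 0 < rho ρ₀ ρinf μ t := hρinf.trans (lt_rho hρ₀ t)
  nlinarith

/-- Trajectories with bounded sliding variable cannot blow up. -/
theorem exists_norm_bound {u : ℝ → (Fin (m + 1) → ℝ) → ℝ} (hx : ContDiffOn ℝ ∞ xdes (Ici 0))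
    (P N : ℝ) :
    ∃ R, ∀ T ≤ N, ∀ x : ℝ → Fin (m + 1) → ℝ, x 0 = x₀ → IsTrajectoryOn f g d u (Ico 0 T) x →
      (∀ t ∈ Ico 0 T, |sigma c xdes t (x t)| ≤ P) → ∀ t ∈ Ico 0 T, ‖x t‖ ≤ R := by
  set C := ∑ j : Fin m, c j ^ 2 with hC
  have hC0 : 0 ≤ C := Finset.sum_nonneg fun j _ => sq_nonneg _
  -- With `V` the sum of the squares of all errors but the last, the chain equations give `V' ≤ K (V
  -- + 1)`: the last error is eliminated through `σ` by Cauchy–Schwarz. The last state equation is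
  -- not used.
  set K := 2 + 2 * C + 2 * P ^ 2 with hK
  set V₀ := ∑ j : Fin m, err xdes 0 x₀ j.castSucc ^ 2 with hV₀
  have hV₀0 : 0 ≤ V₀ := Finset.sum_nonneg fun j _ => sq_nonneg _
  set M := (V₀ + 1) * Real.exp (K * N) with hM
  set Q := M + 2 * P ^ 2 + 2 * C * M with hQ
  have hbd : ∀ i : Fin (m + 1), ∃ D, ∀ t ∈ Icc 0 N,
      ‖iteratedDerivWithin (i : ℕ) xdes (Ici 0) t‖ ≤ D := fun i =>
    isCompact_Icc.exists_bound_of_continuousOn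
      ((continuousOn_iteratedDerivWithin_Ici hx i).mono Icc_subset_Ici_self)
  choose D hD using hbd
  refine ⟨Q + 1 + ∑ i, |D i|, fun T hTN x hx0 h hP t ht => ?_⟩
  set E : Fin (m + 1) → ℝ → ℝ := fun i s => err xdes s (x s) i with hE
  set V : ℝ → ℝ := fun s => ∑ j : Fin m, E j.castSucc s ^ 2 with hV
  have hV0 : ∀ s, 0 ≤ V s := fun s => Finset.sum_nonneg fun j _ => sq_nonneg _
  have hlast : ∀ s ∈ Ico 0 T, E (Fin.last m) s ^ 2 ≤ 2 * P ^ 2 + 2 * C * V s := by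
    intro s hs
    have h1 := Finset.sum_mul_sq_le_sq_mul_sq Finset.univ c fun j : Fin m => E j.castSucc s
    have h2 : E (Fin.last m) s = sigma c xdes s (x s) - ∑ j : Fin m, c j * E j.castSucc s := by
      simp [sigma, hE]
    have h3 : sigma c xdes s (x s) ^ 2 ≤ P ^ 2 :=
      sq_le_sq' (abs_le.1 (hP s hs)).1 (abs_le.1 (hP s hs)).2
    rw [h2]
    nlinarith [sq_nonneg (sigma c xdes s (x s) + ∑ j : Fin m, c j * E j.castSucc s)]
  have hEc : ∀ i, ContinuousOn (E i) (Ico 0 T) := fun i =>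
    continuousOn_graph Ico_subset_Ici_self h.continuousOn (continuousOn_err hx i)
  have hVd : ∀ s ∈ Ioo 0 T,
      HasDerivAt V (∑ j : Fin m, 2 * E j.castSucc s * E j.succ s) s := by
    intro s hs
    refine HasDerivAt.fun_sum fun j _ => ?_
    refine ((h.hasDerivAt_err_castSucc hx (by rwa [interior_Ico]) hs.1 j).pow 2).congr_deriv ?_
    simp [hE]
  have hVle : ∀ s ∈ Ioo 0 T, ∑ j : Fin m, 2 * E j.castSucc s * E j.succ s ≤ K * (V s + 1) := by
    intro s hs
    have h1 : ∑ j : Fin m, 2 * E j.castSucc s * E j.succ s ≤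
        V s + ∑ j : Fin m, E j.succ s ^ 2 := by
      rw [hV, ← Finset.sum_add_distrib]
      exact Finset.sum_le_sum fun j _ => by nlinarith [sq_nonneg (E j.castSucc s - E j.succ s)]
    have h2 : E 0 s ^ 2 + ∑ j : Fin m, E j.succ s ^ 2 = V s + E (Fin.last m) s ^ 2 := by
      rw [← Fin.sum_univ_succ (fun i => E i s ^ 2), Fin.sum_univ_castSucc]
    have h3 := hlast s ⟨hs.1.le, hs.2⟩
    have h4 := mul_nonneg (sq_nonneg P) (hV0 s)
    rw [hK]
    nlinarith [sq_nonneg (E 0 s), hV0 s]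
  have hanti : AntitoneOn (fun s => (V s + 1) * Real.exp (-(K * s))) (Ico 0 T) := by
    have hd : ∀ s ∈ Ioo 0 T, HasDerivAt (fun s => (V s + 1) * Real.exp (-(K * s)))
        ((∑ j : Fin m, 2 * E j.castSucc s * E j.succ s - K * (V s + 1)) * Real.exp (-(K * s)))
        s := by
      intro s hs
      have h1 : HasDerivAt (fun s : ℝ => Real.exp (-(K * s))) (Real.exp (-(K * s)) * -K) s := by
        simpa using ((hasDerivAt_id s).const_mul K).neg.exp
      exact (((hVd s hs).add_const 1).mul h1).congr_deriv (by ring)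
    refine antitoneOn_of_deriv_nonpos (convex_Ico _ _) ?_ ?_ ?_
    · refine ContinuousOn.mul ((continuousOn_finsetSum _ fun j _ => (hEc _).pow 2).add
        continuousOn_const) (by fun_prop)
    · rw [interior_Ico]
      exact fun s hs => (hd s hs).differentiableAt.differentiableWithinAt
    · rw [interior_Ico]
      intro s hs
      rw [(hd s hs).deriv]
      exact mul_nonpos_of_nonpos_of_nonneg (by linarith [hVle s hs]) (Real.exp_pos _).le
  have hVt : V t ≤ M := by
    have h1 := hanti ⟨le_rfl, ht.1.trans_lt ht.2⟩ ht ht.1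
    have h2 : V 0 = V₀ := by simp only [hV, hE, hV₀, hx0]
    simp only [h2, mul_zero, neg_zero, Real.exp_zero, mul_one] at h1
    have h3 : V t + 1 ≤ (V₀ + 1) * Real.exp (K * t) := by
      rwa [Real.exp_neg, ← div_eq_mul_inv, div_le_iff₀ (Real.exp_pos _)] at h1
    have h4 : (V₀ + 1) * Real.exp (K * t) ≤ M := by
      rw [hM]
      have : K * t ≤ K * N := by
        have : 0 ≤ K := by positivity
        gcongr
        exact ht.2.le.trans hTN
      gcongr
    linarith
  have hM0 : 0 ≤ M := by positivity
  have hEQ : ∀ i, E i t ^ 2 ≤ Q := by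
    intro i
    have h5 : 0 ≤ C * M := mul_nonneg hC0 hM0
    refine Fin.lastCases ?_ (fun j => ?_) i
    · have := hlast t ht
      have := mul_le_mul_of_nonneg_left hVt hC0
      rw [hQ]
      linarith
    · have h1 : E j.castSucc t ^ 2 ≤ V t :=
        Finset.single_le_sum (f := fun j : Fin m => E j.castSucc t ^ 2)
          (fun _ _ => sq_nonneg _) (Finset.mem_univ j)
      rw [hQ]
      nlinarith [sq_nonneg P]
  have hQ0 : 0 ≤ Q := (sq_nonneg _).trans (hEQ 0)
  refine (pi_norm_le_iff_of_nonneg (by positivity)).2 fun i => ?_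
  have h1 : |E i t| ≤ Q + 1 := abs_le_of_sq_le_sq (by nlinarith [hEQ i]) (by linarith)
  have h2 : |D i| ≤ ∑ i, |D i| :=
    Finset.single_le_sum (f := fun i => |D i|) (fun _ _ => abs_nonneg _) (Finset.mem_univ i)
  have h3 := hD i t ⟨ht.1, ht.2.le.trans hTN⟩
  have h4 : x t i = E i t + iteratedDerivWithin (i : ℕ) xdes (Ici 0) t := by simp [hE, err]
  have h5 := abs_add_le (E i t) (iteratedDerivWithin (i : ℕ) xdes (Ici 0) t)
  rw [Real.norm_eq_abs] at h3 ⊢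
  rw [h4]
  linarith [le_abs_self (D i)]

end Trajectories

end QSMC

namespace QSMC

/-! ### Existence and continuation of closed-loop trajectories -/

section Continuation

variable {m : ℕ} {f g : (Fin (m + 1) → ℝ) → ℝ} {d xdes : ℝ → ℝ} {c : Fin m → ℝ}
  {ρ₀ ρinf μ : ℝ} {x₀ : Fin (m + 1) → ℝ}

/-- The states of norm less than `b` at which the sliding variable keeps a relative distance to the
boundary of the funnel that is controlled by `b`. -/
def tube (c : Fin m → ℝ) (xdes : ℝ → ℝ) (ρ₀ ρinf μ b : ℝ) : Set (ℝ × (Fin (m + 1) → ℝ)) :=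
  {p | ‖p.2‖ < b ∧ |sigma c xdes p.1 p.2| * (1 + 1 / b) < rho ρ₀ ρinf μ p.1}

theorem tube_mono {b b' : ℝ} (hb : 0 < b) (hbb' : b ≤ b') :
    tube c xdes ρ₀ ρinf μ b ⊆ tube c xdes ρ₀ ρinf μ b' := by
  rintro p ⟨h1, h2⟩
  refine ⟨h1.trans_le hbb', lt_of_le_of_lt ?_ h2⟩
  gcongr

theorem abs_sigma_lt_of_mem_tube {b t : ℝ} {z : Fin (m + 1) → ℝ} (hb : 0 < b)
    (h : (t, z) ∈ tube c xdes ρ₀ ρinf μ b) : |sigma c xdes t z| < rho ρ₀ ρinf μ t := by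
  refine lt_of_le_of_lt ?_ h.2
  exact le_mul_of_one_le_right (abs_nonneg _) (by simp [hb.le])

theorem eventually_mem_tube (hx : ContDiffOn ℝ ∞ xdes (Ici 0)) {b t : ℝ}
    {z : Fin (m + 1) → ℝ} (ht : 0 ≤ t) (h : (t, z) ∈ tube c xdes ρ₀ ρinf μ b) :
    ∀ᶠ p in 𝓝 (t, z), 0 ≤ p.1 → p ∈ tube c xdes ρ₀ ρinf μ b := by
  have h1 : ∀ᶠ p in 𝓝[Ici 0 ×ˢ univ] (t, z),
      |sigma c xdes p.1 p.2| * (1 + 1 / b) < rho ρ₀ ρinf μ p.1 :=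
    Tendsto.eventually_lt
      ((continuousOn_sigma (c := c) hx (t, z) ⟨ht, mem_univ _⟩).abs.mul_const (1 + 1 / b))
      ((continuous_rho (ρ₀ := ρ₀) (ρinf := ρinf) (μ := μ)).comp
        continuous_fst).continuousWithinAt h.2
  have h2 : ∀ᶠ p : ℝ × (Fin (m + 1) → ℝ) in 𝓝 (t, z), ‖p.2‖ < b :=
    continuous_snd.norm.continuousAt.eventually (gt_mem_nhds h.1)
  filter_upwards [eventually_nhdsWithin_iff.1 h1, h2] with p hp1 hp2 hp
  exact ⟨hp2, hp1 ⟨hp, mem_univ _⟩⟩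

/-- Taking `b ≥ 1/(1 - θ)` makes `1 + 1/b ≤ 2 - θ`, and `θ(2 - θ) = 1 - (1 - θ)² < 1`. Thus
non-strict bounds, which survive limits, land in the open tube. -/
theorem exists_mem_tube {R θ : ℝ} (hθ : θ < 1) : ∃ b, 0 < b ∧ ∀ t z, 0 < rho ρ₀ ρinf μ t →
    ‖z‖ ≤ R → |sigma c xdes t z| ≤ θ * rho ρ₀ ρinf μ t → (t, z) ∈ tube c xdes ρ₀ ρinf μ b := by
  refine ⟨|R| + 1 + 1 / (1 - θ), ?_, fun t z hρ hz hσ => ⟨?_, ?_⟩⟩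
  · have : 0 < 1 - θ := by linarith
    positivity
  · have : 0 < 1 / (1 - θ) := one_div_pos.2 (by linarith)
    have := le_abs_self R
    simp only
    linarith
  · have h0 : 0 < 1 - θ := by linarith
    have h1 : 1 / (|R| + 1 + 1 / (1 - θ)) ≤ 1 - θ := by
      rw [div_le_iff₀ (by positivity)]
      have : (1 - θ) * (|R| + 1 + 1 / (1 - θ)) = (1 - θ) * (|R| + 1) + 1 := by field_simp
      rw [this]
      have : 0 ≤ (1 - θ) * (|R| + 1) := by positivity
      linarith
    have h2 : |sigma c xdes t z| * (1 + 1 / (|R| + 1 + 1 / (1 - θ))) ≤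
        |sigma c xdes t z| * (2 - θ) :=
      mul_le_mul_of_nonneg_left (by linarith) (abs_nonneg _)
    have h3 : |sigma c xdes t z| * (2 - θ) ≤ θ * rho ρ₀ ρinf μ t * (2 - θ) :=
      mul_le_mul_of_nonneg_right hσ (by linarith)
    refine (h2.trans h3).trans_lt ?_
    simp only
    nlinarith [mul_pos hρ (mul_pos h0 h0)]

/-- A priori bound: all trajectories on subintervals of `[0, N)` remain in one tube, and so do
their end points. -/
theorem exists_tube (hf : Continuous f) (hx : ContDiffOn ℝ ∞ xdes (Ici 0))
    (hd : PiecewiseContinuous d) {gl db : ℝ} (hdb : ∀ t, 0 ≤ t → |d t| < db)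
    (hgl : 0 < gl) (hg : ∀ z, gl ≤ |g z|) (hρ₀ : 0 < ρ₀) (hρinf : 0 < ρinf) (hμ : 0 < μ)
    (h0 : |sigma c xdes 0 x₀| < rho ρ₀ ρinf μ 0) (N : ℝ) :
    ∃ b, 0 < b ∧ (0, x₀) ∈ tube c xdes ρ₀ ρinf μ b ∧
      ∀ T ≤ N, ∀ y : ℝ → Fin (m + 1) → ℝ, y 0 = x₀ →
        IsTrajectoryOn f g d (control g c xdes ρ₀ ρinf μ) (Ico 0 T) y →
        (∀ t ∈ Ico 0 T, (t, y t) ∈ tube c xdes ρ₀ ρinf μ b) ∧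
        (0 < T → ContinuousOn y (Icc 0 T) → (T, y T) ∈ tube c xdes ρ₀ ρinf μ b) := by
  have hρ : ∀ t, 0 < rho ρ₀ ρinf μ t := fun t => hρinf.trans (lt_rho hρ₀ t)
  obtain ⟨R, hR⟩ := exists_norm_bound (f := f) (g := g) (d := d) (c := c) (x₀ := x₀)
    (u := control g c xdes ρ₀ ρinf μ) hx (ρ₀ + ρinf) N
  obtain ⟨H, hH⟩ := exists_drift_bound (m := m) (c := c) hf hx hdb N R
  obtain ⟨θ', hq, hθ', htan⟩ := exists_tan_ge (A := H + μ * ρ₀) (gl := gl)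
    (div_nonneg (abs_nonneg _) (hρ 0).le) ((div_lt_one (hρ 0)).2 h0) hgl
  have hθ'0 : 0 < θ' := (div_nonneg (abs_nonneg _) (hρ 0).le).trans_lt hq
  rw [div_lt_iff₀ (hρ 0)] at hq
  set θ := (θ' + 1) / 2 with hθ
  have hθ0 : |sigma c xdes 0 x₀| < θ * rho ρ₀ ρinf μ 0 := by nlinarith [hρ 0]
  obtain ⟨b, hb, hmem⟩ := exists_mem_tube (c := c) (xdes := xdes) (ρ₀ := ρ₀) (ρinf := ρinf)
    (μ := μ) (R := max R ‖x₀‖) (θ := θ) (by linarith)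
  -- There is no circularity: the funnel bound holds for each trajectory with its own constants, and
  -- its uniform consequence `|σ| ≤ ρ₀ + ρ_∞` then yields `R`, `H` and `θ` common to all.
  have hbd : ∀ T ≤ N, ∀ y : ℝ → Fin (m + 1) → ℝ, y 0 = x₀ →
      IsTrajectoryOn f g d (control g c xdes ρ₀ ρinf μ) (Ico 0 T) y →
      ∀ t ∈ Ico 0 T, ‖y t‖ ≤ R ∧ |sigma c xdes t (y t)| ≤ θ * rho ρ₀ ρinf μ t := by
    intro T hT y hy0 hy
    have h1 := hy.abs_sigma_lt_rho hf hx hd hdb hgl hg hρ₀ hρinf hμ (by rwa [hy0])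
    have h2 := hR T hT y hy0 hy fun t ht => (h1 t ht).le.trans (rho_le hρ₀ hμ ht.1)
    have h3 := hy.abs_sigma_lt_of_drift_le hx hd hg hρ₀ hρinf hμ (θ := θ) hθ'0 (by linarith)
      (by linarith) (fun t ht => hH t ⟨ht.1.le, ht.2.le.trans hT⟩ _ (h2 t ⟨ht.1.le, ht.2⟩)) htan
      (by rwa [hy0])
    exact fun t ht => ⟨h2 t ht, (h3 t ht).le⟩
  refine ⟨b, hb, hmem _ _ (hρ 0) (le_max_right _ _) hθ0.le, fun T hT y hy0 hy => ⟨?_, ?_⟩⟩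
  · intro t ht
    obtain ⟨h1, h2⟩ := hbd T hT y hy0 hy t ht
    exact hmem _ _ (hρ t) (h1.trans (le_max_left _ _)) h2
  · intro hT0 hyc
    have hle : 𝓝[<] T ≤ 𝓝[Icc 0 T] T := by
      rw [← nhdsWithin_Ico_eq_nhdsLT hT0]
      exact nhdsWithin_mono _ Ico_subset_Icc_self
    have hTmem : T ∈ Icc 0 T := ⟨hT0.le, le_rfl⟩
    have hev : ∀ᶠ t in 𝓝[<] T, t ∈ Ico 0 T := Ico_mem_nhdsLT hT0
    refine hmem _ _ (hρ T) (le_trans ?_ (le_max_left _ _)) ?_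
    · exact le_of_tendsto ((hyc T hTmem).norm.tendsto.mono_left hle)
        (hev.mono fun t ht => (hbd T hT y hy0 hy t ht).1)
    · have hσ : ContinuousOn (fun t => |sigma c xdes t (y t)|) (Icc 0 T) :=
        (continuousOn_graph Icc_subset_Ici_self hyc (continuousOn_sigma hx)).abs
      have hρc : ContinuousOn (fun t => θ * rho ρ₀ ρinf μ t) (Icc 0 T) :=
        (continuous_rho.const_mul θ).continuousOn
      exact le_of_tendsto_of_tendsto ((hσ T hTmem).tendsto.mono_left hle)
        ((hρc T hTmem).tendsto.mono_left hle)
        (hev.mono fun t ht => (hbd T hT y hy0 hy t ht).2)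

/-- The right-hand side of the closed-loop system. -/
noncomputable def closedLoop (f g : (Fin (m + 1) → ℝ) → ℝ) (d : ℝ → ℝ)
    (u : ℝ → (Fin (m + 1) → ℝ) → ℝ) (t : ℝ) (z : Fin (m + 1) → ℝ) : Fin (m + 1) → ℝ :=
  Fin.snoc (α := fun _ => ℝ) (fun j : Fin m => z j.succ) (f z + g z * u t z + d t)

@[simp]
theorem closedLoop_castSucc (u : ℝ → (Fin (m + 1) → ℝ) → ℝ) (t : ℝ) (z : Fin (m + 1) → ℝ)
    (j : Fin m) : closedLoop f g d u t z j.castSucc = z j.succ := by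
  simp [closedLoop]

@[simp]
theorem closedLoop_last (u : ℝ → (Fin (m + 1) → ℝ) → ℝ) (t : ℝ) (z : Fin (m + 1) → ℝ) :
    closedLoop f g d u t z (Fin.last m) = f z + g z * u t z + d t := by
  simp [closedLoop]

/-- `i` is a component of the closed loop in which the disturbance does not jump at time `t`. -/
def IsRegularAt (d : ℝ → ℝ) (t : ℝ) (i : Fin (m + 1)) : Prop := i = Fin.last m → ContinuousAt d t

theorem isTrajectoryOn_iff {u : ℝ → (Fin (m + 1) → ℝ) → ℝ} {J : Set ℝ}
    {x : ℝ → Fin (m + 1) → ℝ} : IsTrajectoryOn f g d u J x ↔ ContinuousOn x J ∧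
      ∀ t ∈ interior J, ∀ i, IsRegularAt d t i →
        HasDerivAt (fun s => x s i) (closedLoop f g d u t (x t) i) t := by
  constructor
  · refine fun h => ⟨h.continuousOn, fun t ht i => Fin.lastCases (fun hi => ?_) (fun j _ => ?_) i⟩
    · rw [closedLoop_last]
      exact h.last t ht (hi rfl)
    · rw [closedLoop_castSucc]
      exact h.chain t ht j
  · refine fun h => ⟨h.1, fun t ht j => ?_, fun t ht hdt => ?_⟩
    · have := h.2 t ht j.castSucc fun hj => absurd hj (Fin.castSucc_lt_last j).ne
      rwa [closedLoop_castSucc] at this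
    · have := h.2 t ht (Fin.last m) fun _ => hdt
      rwa [closedLoop_last] at this

theorem continuousAt_closedLoop (hf : Continuous f) (hgc : Continuous g)
    (hx : ContDiffOn ℝ ∞ xdes (Ici 0)) {t : ℝ} {z : Fin (m + 1) → ℝ} (ht : 0 < t)
    (hσ : |sigma c xdes t z| < rho ρ₀ ρinf μ t) {i : Fin (m + 1)} (hi : IsRegularAt d t i) :
    ContinuousAt (fun p : ℝ × (Fin (m + 1) → ℝ) =>
      closedLoop f g d (control g c xdes ρ₀ ρinf μ) p.1 p.2 i) (t, z) := by
  revert hi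
  refine Fin.lastCases (fun hi => ?_) (fun j _ => ?_) i
  · have hρ : 0 < rho ρ₀ ρinf μ t := (abs_nonneg _).trans_lt hσ
    have hπ := Real.pi_pos
    rw [abs_lt] at hσ
    have h1 : ContinuousAt (fun p : ℝ × (Fin (m + 1) → ℝ) => sigma c xdes p.1 p.2) (t, z) :=
      (continuousOn_sigma hx).continuousAt (prod_mem_nhds (Ici_mem_nhds ht) univ_mem)
    have h2 : ContinuousAt (fun p : ℝ × (Fin (m + 1) → ℝ) => rho ρ₀ ρinf μ p.1) (t, z) :=
      (continuous_rho.comp continuous_fst).continuousAt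
    have h3 : ContinuousAt (fun p : ℝ × (Fin (m + 1) → ℝ) =>
        Real.pi * sigma c xdes p.1 p.2 / (2 * rho ρ₀ ρinf μ p.1)) (t, z) :=
      (h1.const_mul _).div (h2.const_mul _) (by positivity)
    have h4 : ContinuousAt Real.tan (Real.pi * sigma c xdes t z / (2 * rho ρ₀ ρinf μ t)) := by
      refine Real.continuousAt_tan.2 (Real.cos_pos_of_mem_Ioo ⟨?_, ?_⟩).ne'
      · rw [lt_div_iff₀ (by positivity)]
        nlinarith
      · rw [div_lt_iff₀ (by positivity)]
        nlinarith
    have h5 : ContinuousAt (fun p : ℝ × (Fin (m + 1) → ℝ) => d p.1) (t, z) :=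
      ContinuousAt.comp (f := Prod.fst) (hi rfl) continuousAt_fst
    have h6 : ContinuousAt (fun p : ℝ × (Fin (m + 1) → ℝ) => Real.tan
        (Real.pi * sigma c xdes p.1 p.2 / (2 * rho ρ₀ ρinf μ p.1))) (t, z) :=
      ContinuousAt.comp (g := Real.tan) h4 h3
    simp only [closedLoop_last, mul_control]
    exact ((hf.comp continuous_snd).continuousAt.add
      ((hgc.comp continuous_snd).abs.continuousAt.mul h6).neg).add h5
  · simp only [closedLoop_castSucc]
    fun_prop

/-- In the tube `|σ|/ρ` is at most `1/(1 + 1/b)`, which keeps the argument of the tangent away from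
its poles, uniformly in time. -/
theorem exists_closedLoop_bound (hf : Continuous f) (hgc : Continuous g)
    (hρ₀ : 0 < ρ₀) (hρinf : 0 < ρinf) {db : ℝ} (hdb : ∀ t, 0 ≤ t → |d t| < db) {b : ℝ}
    (hb : 0 < b) :
    ∃ B, ∀ t z, 0 ≤ t → (t, z) ∈ tube c xdes ρ₀ ρinf μ b → ∀ i : Fin (m + 1),
      |closedLoop f g d (control g c xdes ρ₀ ρinf μ) t z i| ≤ B := by
  obtain ⟨Bf, hBf⟩ := (isCompact_closedBall (0 : Fin (m + 1) → ℝ) b).exists_bound_of_continuousOn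
    hf.continuousOn
  obtain ⟨Bg, hBg⟩ := (isCompact_closedBall (0 : Fin (m + 1) → ℝ) b).exists_bound_of_continuousOn
    hgc.continuousOn
  set τ := Real.tan (Real.pi * (1 / (1 + 1 / b)) / 2) with hτ
  refine ⟨max b (Bf + Bg * τ + db), fun t z ht hz i => ?_⟩
  have hπ := Real.pi_pos
  have hzb : z ∈ Metric.closedBall (0 : Fin (m + 1) → ℝ) b := by simpa using hz.1.le
  refine Fin.lastCases ?_ (fun j => ?_) i
  · rw [closedLoop_last, mul_control]
    refine le_trans ?_ (le_max_right _ _)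
    have hρ : 0 < rho ρ₀ ρinf μ t := hρinf.trans (lt_rho hρ₀ t)
    set y := Real.pi * sigma c xdes t z / (2 * rho ρ₀ ρinf μ t) with hy
    set φ := Real.pi * (1 / (1 + 1 / b)) / 2 with hφ
    have hφlt : φ < Real.pi / 2 := by
      have : 1 / (1 + 1 / b) < 1 := (div_lt_one (by positivity)).2 (by simp [hb])
      rw [hφ]
      nlinarith
    have hyφ : |y| ≤ φ := by
      rw [hy, abs_div, abs_mul, abs_of_pos hπ, abs_of_pos (by positivity : 0 < 2 * rho ρ₀ ρinf μ t),
        hφ, div_le_div_iff₀ (by positivity) two_pos]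
      have h2 : |sigma c xdes t z| ≤ 1 / (1 + 1 / b) * rho ρ₀ ρinf μ t := by
        rw [div_mul_eq_mul_div, one_mul, le_div_iff₀ (by positivity)]
        exact hz.2.le
      nlinarith
    rw [abs_le] at hyφ
    have hmono := Real.strictMonoOn_tan.monotoneOn
    have hφmem : φ ∈ Ioo (-(Real.pi / 2)) (Real.pi / 2) := ⟨by linarith, hφlt⟩
    have hymem : y ∈ Ioo (-(Real.pi / 2)) (Real.pi / 2) := ⟨by linarith, by linarith⟩
    have hnmem : -φ ∈ Ioo (-(Real.pi / 2)) (Real.pi / 2) := ⟨by linarith, by linarith⟩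
    have ht1 : Real.tan y ≤ τ := hmono hymem hφmem hyφ.2
    have ht2 : -τ ≤ Real.tan y := by
      rw [hτ, ← Real.tan_neg]
      exact hmono hnmem hymem hyφ.1
    have htan : |Real.tan y| ≤ τ := abs_le.2 ⟨ht2, ht1⟩
    have h1 := hBf z hzb
    have h2 := hBg z hzb
    have h3 := hdb t ht
    rw [Real.norm_eq_abs] at h1 h2
    have h4 : |(|g z| * Real.tan y)| ≤ Bg * τ := by
      rw [abs_mul, abs_abs]
      exact mul_le_mul h2 htan (abs_nonneg _) ((abs_nonneg _).trans h2)
    have h5 := abs_add_le (f z + -(|g z| * Real.tan y)) (d t)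
    have h6 := abs_add_le (f z) (-(|g z| * Real.tan y))
    rw [abs_neg] at h6
    linarith
  · rw [closedLoop_castSucc]
    exact ((norm_le_pi_norm z j.succ).trans hz.1.le).trans (le_max_left _ _)

/-- Two solutions with the same right-hand side are compared with this; the countable set absorbs
the jumps of the disturbance. -/
theorem eq_of_hasDerivAt_zero_off_countable {w : ℝ → ℝ} {a b : ℝ} {S : Set ℝ} (hab : a ≤ b)
    (hS : S.Countable) (hw : ContinuousOn w (Icc a b))
    (h : ∀ t ∈ Ioo a b \ S, HasDerivAt w 0 t) : w b = w a := by
  have := MeasureTheory.integral_eq_of_hasDerivAt_off_countable w (fun _ => 0) hS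
    (by rwa [uIcc_of_le hab]) (by rwa [min_eq_left hab, max_eq_right hab])
    (by simp)
  simp only [intervalIntegral.integral_zero] at this
  linarith

/-- The closed-loop vector field with the state before time `T` replaced by the path `x`. -/
noncomputable def replay (f g : (Fin (m + 1) → ℝ) → ℝ) (d : ℝ → ℝ)
    (u : ℝ → (Fin (m + 1) → ℝ) → ℝ) (T : ℝ) (x : ℝ → Fin (m + 1) → ℝ) (t : ℝ)
    (z : Fin (m + 1) → ℝ) : Fin (m + 1) → ℝ :=
  if t < T then closedLoop f g d u t (x t) else closedLoop f g d u t z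

/-- Solutions of the replayed system continue the replayed trajectory. -/
theorem isTrajectoryOn_of_replay (hf : Continuous f) (hgc : Continuous g)
    (hx : ContDiffOn ℝ ∞ xdes (Ici 0)) (hd : PiecewiseContinuous d) {T S : ℝ} (hTS : T ≤ S)
    {x y : ℝ → Fin (m + 1) → ℝ}
    (htraj : IsTrajectoryOn f g d (control g c xdes ρ₀ ρinf μ) (Ico 0 T) x)
    (hσx : ∀ t ∈ Ico 0 T, |sigma c xdes t (x t)| < rho ρ₀ ρinf μ t)
    (hxy : y 0 = x 0) (hyc : ContinuousOn y (Ico 0 S))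
    (hσy : ∀ t ∈ Ico 0 S, T ≤ t → |sigma c xdes t (y t)| < rho ρ₀ ρinf μ t)
    (hy : ∀ t ∈ Ioo 0 S, ∀ i, ContinuousAt (fun p : ℝ × (Fin (m + 1) → ℝ) =>
      replay f g d (control g c xdes ρ₀ ρinf μ) T x p.1 p.2 i) (t, y t) →
      HasDerivAt (fun s => y s i) (replay f g d (control g c xdes ρ₀ ρinf μ) T x t (y t) i) t) :
    EqOn y x (Ico 0 T) ∧
      IsTrajectoryOn f g d (control g c xdes ρ₀ ρinf μ) (Ico 0 S) y := by
  have htraj' := isTrajectoryOn_iff.1 htraj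
  rw [interior_Ico] at htraj'
  -- Before `T` the replayed field ignores the state, so `y` and `x` have the same derivative off
  -- the jumps and agree without any uniqueness theorem.
  have hyd : ∀ t ∈ Ioo 0 T, ∀ i, IsRegularAt d t i → HasDerivAt (fun s => y s i)
      (closedLoop f g d (control g c xdes ρ₀ ρinf μ) t (x t) i) t := by
    intro t ht i hi
    have hxt : ContinuousAt x t := htraj.continuousOn.continuousAt (Ico_mem_nhds ht.1 ht.2)
    have h1 := continuousAt_closedLoop hf hgc hx ht.1 (hσx t ⟨ht.1.le, ht.2⟩) hi
    have h2 : ContinuousAt (fun p : ℝ × (Fin (m + 1) → ℝ) => (p.1, x p.1)) (t, y t) :=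
      continuousAt_fst.prodMk (ContinuousAt.comp (f := Prod.fst) hxt continuousAt_fst)
    have h3 : ContinuousAt (fun p : ℝ × (Fin (m + 1) → ℝ) =>
        closedLoop f g d (control g c xdes ρ₀ ρinf μ) p.1 (x p.1) i) (t, y t) :=
      ContinuousAt.comp (f := fun p : ℝ × (Fin (m + 1) → ℝ) => (p.1, x p.1))
        (g := fun p => closedLoop f g d (control g c xdes ρ₀ ρinf μ) p.1 p.2 i) (by exact h1) h2
    have h4 : (fun p : ℝ × (Fin (m + 1) → ℝ) =>
        closedLoop f g d (control g c xdes ρ₀ ρinf μ) p.1 (x p.1) i) =ᶠ[𝓝 (t, y t)]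
        fun p => replay f g d (control g c xdes ρ₀ ρinf μ) T x p.1 p.2 i := by
      filter_upwards [continuousAt_fst.eventually (gt_mem_nhds ht.2)] with p hp
      rw [replay, if_pos hp]
    have h5 := hy t ⟨ht.1, ht.2.trans_le hTS⟩ i (h3.congr h4)
    rwa [replay, if_pos ht.2] at h5
  have heq : EqOn y x (Ico 0 T) := by
    intro t ht
    funext i
    have h1 := eq_of_hasDerivAt_zero_off_countable (w := fun s => y s i - x s i) ht.1
      (hd.1 T).countable ?_ fun s hs => ?_
    · simp only [hxy, sub_self] at h1
      linarith
    · have h2 := (hyc.mono fun s (hs : s ∈ Icc 0 t) => ⟨hs.1, hs.2.trans_lt (ht.2.trans_le hTS)⟩)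
      have h3 := htraj.continuousOn.mono fun s (hs : s ∈ Icc 0 t) => ⟨hs.1, hs.2.trans_lt ht.2⟩
      exact (continuousOn_pi.1 h2 i).sub (continuousOn_pi.1 h3 i)
    · have hsT : s ∈ Ioo 0 T := ⟨hs.1.1, hs.1.2.trans ht.2⟩
      have hreg : IsRegularAt d s i := fun _ => by
        by_contra hcon
        exact hs.2 ⟨hsT, hcon⟩
      exact ((hyd s hsT i hreg).sub (htraj'.2 s hsT i hreg)).congr_deriv (sub_self _)
  refine ⟨heq, isTrajectoryOn_iff.2 ⟨hyc, ?_⟩⟩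
  rw [interior_Ico]
  intro t ht i hi
  rcases lt_or_ge t T with htT | htT
  · rw [heq ⟨ht.1.le, htT⟩]
    exact hyd t ⟨ht.1, htT⟩ i hi
  · have h1 := continuousAt_closedLoop hf hgc hx ht.1 (hσy t ⟨ht.1.le, ht.2⟩ htT) hi
    have hyt : ContinuousAt y t := hyc.continuousAt (Ico_mem_nhds ht.1 ht.2)
    have h2 : ContinuousAt (fun p : ℝ × (Fin (m + 1) → ℝ) => (p.1, y p.1)) (t, y t) :=
      continuousAt_fst.prodMk (ContinuousAt.comp (f := Prod.fst) hyt continuousAt_fst)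
    have h3 : ContinuousAt (fun p : ℝ × (Fin (m + 1) → ℝ) =>
        closedLoop f g d (control g c xdes ρ₀ ρinf μ) p.1 (y p.1) i) (t, y t) :=
      ContinuousAt.comp (f := fun p : ℝ × (Fin (m + 1) → ℝ) => (p.1, y p.1))
        (g := fun p => closedLoop f g d (control g c xdes ρ₀ ρinf μ) p.1 p.2 i) (by exact h1) h2
    -- At `t = T` both branches have the same limit. The first is written with `y`, which is
    -- continuous at `T`, while `x` need not be; the two agree before `T`.
    have h4 : ContinuousAt (fun p : ℝ × (Fin (m + 1) → ℝ) => if p.1 < T then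
        closedLoop f g d (control g c xdes ρ₀ ρinf μ) p.1 (y p.1) i else
        closedLoop f g d (control g c xdes ρ₀ ρinf μ) p.1 p.2 i) (t, y t) := by
      have := Tendsto.if' (p := fun p : ℝ × (Fin (m + 1) → ℝ) => p.1 < T) h3.tendsto h1.tendsto
      rw [ContinuousAt]
      convert this using 2
      simp
    have h5 : (fun p : ℝ × (Fin (m + 1) → ℝ) => if p.1 < T then
        closedLoop f g d (control g c xdes ρ₀ ρinf μ) p.1 (y p.1) i else
        closedLoop f g d (control g c xdes ρ₀ ρinf μ) p.1 p.2 i) =ᶠ[𝓝 (t, y t)]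
        fun p => replay f g d (control g c xdes ρ₀ ρinf μ) T x p.1 p.2 i := by
      filter_upwards [continuousAt_fst.eventually (lt_mem_nhds ht.1)] with p hp
      rw [replay]
      split_ifs with hpT
      · rw [heq ⟨hp.le, hpT⟩]
      · rfl
    have h6 := hy t ht i (h4.congr h5)
    rwa [replay, if_neg (not_lt.2 htT)] at h6

/-- Every closed-loop trajectory extends to all times. -/
theorem IsTrajectoryOn.exists_extension (hf : Continuous f) (hgc : Continuous g)
    (hx : ContDiffOn ℝ ∞ xdes (Ici 0)) (hd : PiecewiseContinuous d)
    {gl db : ℝ} (hdb : ∀ t, 0 ≤ t → |d t| < db) (hgl : 0 < gl) (hg : ∀ z, gl ≤ |g z|)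
    (hρ₀ : 0 < ρ₀) (hρinf : 0 < ρinf) (hμ : 0 < μ) {T : ℝ}
    {x : ℝ → Fin (m + 1) → ℝ}
    (htraj : IsTrajectoryOn f g d (control g c xdes ρ₀ ρinf μ) (Ico 0 T) x)
    (h0 : |sigma c xdes 0 (x 0)| < rho ρ₀ ρinf μ 0) :
    ∃ y : ℝ → Fin (m + 1) → ℝ, y 0 = x 0 ∧ EqOn y x (Ico 0 T) ∧
      IsTrajectoryOn f g d (control g c xdes ρ₀ ρinf μ) (Ici 0) y := by
  choose b hb hb0 htube using fun N : ℕ => exists_tube (f := f) (g := g) (x₀ := x 0) hf hx hd hdb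
    hgl hg hρ₀ hρinf hμ h0 (N : ℝ)
  -- The radii for different horizons are unrelated; their running maxima make the tubes increasing.
  set B : ℕ → ℝ := fun N => partialSups b N with hB
  have hbB : ∀ N, b N ≤ B N := fun N => le_partialSups b N
  have hBpos : ∀ N, 0 < B N := fun N => (hb N).trans_le (hbB N)
  have hBmono : Monotone B := (partialSups b).monotone
  have hσx := htraj.abs_sigma_lt_rho hf hx hd hdb hgl hg hρ₀ hρinf hμ h0
  set F := replay f g d (control g c xdes ρ₀ ρinf μ) T x with hF
  -- No constraint is needed before `T`, where the replayed field depends on `x` only and is bounded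
  -- because `x` itself stays in a tube.
  set K : ℕ → Set (ℝ × (Fin (m + 1) → ℝ)) := fun N =>
    {p | p.1 < T ∨ p ∈ tube c xdes ρ₀ ρinf μ (B N)} with hK
  have hσK : ∀ t y, (t, y) ∈ K ⌈t⌉₊ → T ≤ t → |sigma c xdes t y| < rho ρ₀ ρinf μ t :=
    fun t y h hTt => abs_sigma_lt_of_mem_tube (hBpos _) (h.resolve_left (not_lt.2 hTt))
  have hsol := exists_solution_of_tube F (x 0) K ?_ ?_ ?_ ?_ ?_
  · obtain ⟨y, hy0, hyc, hyK, hyd⟩ := hsol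
    have key : ∀ S, T ≤ S → EqOn y x (Ico 0 T) ∧
        IsTrajectoryOn f g d (control g c xdes ρ₀ ρinf μ) (Ico 0 S) y := fun S hS =>
      isTrajectoryOn_of_replay hf hgc hx hd hS htraj hσx hy0 (hyc.mono Ico_subset_Ici_self)
        (fun t ht => hσK t _ (hyK t ht.1)) fun t ht => hyd t ht.1
    refine ⟨y, hy0, (key T le_rfl).1, isTrajectoryOn_iff.2 ⟨hyc, ?_⟩⟩
    rw [interior_Ici]
    intro t ht i hi
    have h1 := (isTrajectoryOn_iff.1 (key (max T (t + 1)) (le_max_left _ _)).2).2 t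
    rw [interior_Ico] at h1
    exact h1 ⟨ht, (lt_add_one t).trans_le (le_max_right _ _)⟩ i hi
  · exact fun N N' h p hp => hp.imp_right fun hp => tube_mono (hBpos N) (hBmono h) hp
  · rintro N t z ht (hz | hz)
    · filter_upwards [continuousAt_fst.eventually (gt_mem_nhds hz)] with p hp _
      exact Or.inl hp
    · filter_upwards [eventually_mem_tube hx ht hz] with p hp hp0
      exact Or.inr (hp hp0)
  · intro N
    obtain ⟨M₁, hM₁⟩ := exists_closedLoop_bound (c := c) (xdes := xdes) (μ := μ) hf hgc hρ₀ hρinf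
      hdb (hb ⌈T⌉₊)
    obtain ⟨M₂, hM₂⟩ := exists_closedLoop_bound (c := c) (xdes := xdes) (μ := μ) hf hgc hρ₀ hρinf
      hdb (hBpos N)
    refine ⟨max M₁ M₂, fun t z ht _ hz i => ?_⟩
    rw [hF, replay]
    split_ifs with htT
    · exact (hM₁ t _ ht ((htube ⌈T⌉₊ T (Nat.le_ceil T) x rfl htraj).1 t ⟨ht, htT⟩) i).trans
        (le_max_left _ _)
    · exact (hM₂ t z ht (hz.resolve_left htT) i).trans (le_max_right _ _)
  · exact Or.inr (tube_mono (hb 0) (hbB 0) (hb0 0))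
  · intro S hS y hy0 hyc hyK hyd
    rcases lt_or_ge S T with hST | hST
    · exact Or.inl hST
    · have h1 := (isTrajectoryOn_of_replay hf hgc hx hd hST htraj hσx hy0
        (hyc.mono Ico_subset_Icc_self) (fun t ht => hσK t _ (hyK t ht)) hyd).2
      exact Or.inr (tube_mono (hb _) (hbB _)
        ((htube ⌈S⌉₊ S (Nat.le_ceil S) y hy0 h1).2 hS hyc))

end Continuation

end QSMC

namespace QSMC

/-! ### Reaching time and tracking -/

section Reaching

variable {m : ℕ} {f g : (Fin (m + 1) → ℝ) → ℝ} {d xdes : ℝ → ℝ} {c : Fin m → ℝ}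
  {ρ₀ ρinf μ : ℝ}

theorem rho_antitone (hρ₀ : 0 < ρ₀) (hμ : 0 < μ) : Antitone (rho ρ₀ ρinf μ) := by
  intro s t hst
  have : -μ * t ≤ -μ * s := by nlinarith
  unfold rho
  gcongr

theorem rho_reaching_time {ε : ℝ} (hρ₀ : 0 < ρ₀) (hμ : 0 < μ) (hε : ρinf < ε) :
    rho ρ₀ ρinf μ (1 / μ * Real.log (ρ₀ / (ε - ρinf))) = ε := by
  have h1 : 0 < ε - ρinf := sub_pos.2 hε
  have h2 : -μ * (1 / μ * Real.log (ρ₀ / (ε - ρinf))) = -Real.log (ρ₀ / (ε - ρinf)) := by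
    field_simp
  rw [rho, h2, Real.exp_neg, Real.exp_log (by positivity)]
  field_simp
  ring

theorem tendsto_rho (hμ : 0 < μ) : Tendsto (rho ρ₀ ρinf μ) atTop (𝓝 ρinf) := by
  have h1 : Tendsto (fun t : ℝ => Real.exp (-(μ * t))) atTop (𝓝 0) :=
    Real.tendsto_exp_neg_atTop_nhds_zero.comp (tendsto_id.const_mul_atTop hμ)
  have h2 := (h1.const_mul ρ₀).add_const ρinf
  simp only [mul_zero, zero_add] at h2
  refine h2.congr fun t => ?_
  rw [rho, neg_mul]

/-- At the time `S` with `ρ(S) = ε` the bound `|s| < ε` is strict, so by continuity it holds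
slightly earlier; after `S` the monotonicity of `ρ` takes over. -/
theorem exists_reaching_time {s : ℝ → ℝ} {ε : ℝ} (hs : ContinuousOn s (Ici 0))
    (hsρ : ∀ t, 0 ≤ t → |s t| < rho ρ₀ ρinf μ t) (hρ₀ : 0 < ρ₀) (hρinf : 0 < ρinf) (hμ : 0 < μ)
    (hε : ρinf < ε) (hερ : ε < ρ₀) :
    ∃ tr, 0 ≤ tr ∧ tr < 1 / μ * Real.log (ρ₀ / (ε - ρinf)) ∧ ∀ t, tr ≤ t → |s t| < ε := by
  set S := 1 / μ * Real.log (ρ₀ / (ε - ρinf)) with hS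
  have hS0 : 0 < S := by
    have : 1 < ρ₀ / (ε - ρinf) := (one_lt_div (sub_pos.2 hε)).2 (by linarith)
    have := Real.log_pos this
    positivity
  have hSε : rho ρ₀ ρinf μ S = ε := rho_reaching_time hρ₀ hμ hε
  have hev : ∀ᶠ t in 𝓝[<] S, |s t| < ε := by
    have h1 : ContinuousAt (fun t => |s t|) S := (hs.continuousAt (Ici_mem_nhds hS0)).abs
    have h2 : |s S| < ε := hSε ▸ hsρ S hS0.le
    exact mem_nhdsWithin_of_mem_nhds (h1.eventually (gt_mem_nhds h2))
  obtain ⟨l, hl, hsub⟩ := (mem_nhdsLT_iff_exists_Ioo_subset).1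
    (hev.and (mem_nhdsWithin_of_mem_nhds (lt_mem_nhds hS0)))
  have hl : l < S := hl
  have htr : (l + S) / 2 ∈ Ioo l S := ⟨by linarith, by linarith⟩
  refine ⟨(l + S) / 2, (hsub htr).2.le, htr.2, fun t ht => ?_⟩
  rcases lt_or_ge t S with htS | htS
  · exact (hsub ⟨htr.1.trans_le ht, htS⟩).1
  · exact (hsρ t (hS0.le.trans htS)).trans_le (hSε ▸ rho_antitone hρ₀ hμ htS)

/-- The chain of errors, continued by zero. -/
noncomputable def errSeq (xdes : ℝ → ℝ) (x : ℝ → Fin (m + 1) → ℝ) (j : ℕ) (t : ℝ) : ℝ :=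
  if hj : j < m + 1 then err xdes t (x t) ⟨j, hj⟩ else 0

theorem errSeq_val (x : ℝ → Fin (m + 1) → ℝ) (i : Fin (m + 1)) (t : ℝ) :
    errSeq xdes x i t = err xdes t (x t) i :=
  dif_pos i.2

/-- With binomial coefficients, `σ = (d/dt + a)^m e`. -/
theorem cascade_errSeq_eq_sigma {a : ℝ}
    (hc : ∀ j : Fin m, c j = (m.choose (m - (j : ℕ)) : ℝ) * a ^ (m - (j : ℕ)))
    (x : ℝ → Fin (m + 1) → ℝ) (t : ℝ) :
    cascade a (errSeq xdes x) m 0 t = sigma c xdes t (x t) := by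
  rw [cascade_eq_sum, Finset.sum_range_succ, sigma, Finset.sum_range]
  congr 1
  · refine Finset.sum_congr rfl fun j _ => ?_
    rw [hc, Nat.choose_symm j.2.le, zero_add]
    congr 1
    exact errSeq_val x j.castSucc t
  · simpa using errSeq_val (xdes := xdes) x (Fin.last m) t

theorem IsTrajectoryOn.eventually_abs_err_lt {u : ℝ → (Fin (m + 1) → ℝ) → ℝ}
    {x : ℝ → Fin (m + 1) → ℝ} (h : IsTrajectoryOn f g d u (Ici 0) x)
    (hx : ContDiffOn ℝ ∞ xdes (Ici 0)) (hμ : 0 < μ)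
    (hσ : ∀ t, 0 ≤ t → |sigma c xdes t (x t)| < rho ρ₀ ρinf μ t) {a ε : ℝ} (ha : 0 < a)
    (hc : ∀ j : Fin m, c j = (m.choose (m - (j : ℕ)) : ℝ) * a ^ (m - (j : ℕ)))
    (hε : ρinf < ε) (i : Fin (m + 1)) :
    ∀ᶠ t in atTop, |err xdes t (x t) i| < (2 * a) ^ (i : ℕ) * (ε / a ^ m) := by
  have h1 : ∀ᶠ t in atTop, ∀ j < m,
      HasDerivAt (errSeq xdes x j) (errSeq xdes x (j + 1) t) t := by
    filter_upwards [eventually_gt_atTop 0] with t ht j hj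
    have h2 := h.hasDerivAt_err_castSucc hx (by rwa [interior_Ici]) ht ⟨j, hj⟩
    convert h2 using 1
    · funext s
      exact errSeq_val x (Fin.castSucc ⟨j, hj⟩) s
    · exact errSeq_val x (Fin.succ ⟨j, hj⟩) t
  -- The ultimate bound on `σ` is `ρ_∞`, not `ε`; the gap between them pays for the strict margins
  -- of the filters.
  have h2 : ∀ δ > ρinf, ∀ᶠ t in atTop, |cascade a (errSeq xdes x) m 0 t| < δ := by
    intro δ hδ
    filter_upwards [eventually_ge_atTop 0, (tendsto_rho (ρ₀ := ρ₀) hμ).eventually (gt_mem_nhds hδ)]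
      with t ht htδ
    rw [cascade_errSeq_eq_sigma hc]
    exact (hσ t ht).trans htδ
  simpa only [errSeq_val] using eventually_abs_lt_of_cascade ha h1 h2 hε (Nat.lt_succ_iff.1 i.2)

end Reaching

end QSMC

/-! ### The closed-loop theorem -/

theorem theorem1 {m : ℕ} (f g : (Fin (m + 1) → ℝ) → ℝ) (d xdes : ℝ → ℝ)
    (c : Fin m → ℝ) (ρ₀ ρinf μ : ℝ) (x₀ : Fin (m + 1) → ℝ)
    (hf : Continuous f)
    (hg : ∃ gl : ℝ, 0 < gl ∧ ∀ z, gl ≤ |g z|)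
    (hd : QSMC.PiecewiseContinuous d)
    (hdb : ∃ db : ℝ, 0 < db ∧ ∀ t : ℝ, 0 ≤ t → |d t| < db)
    (hxdes : ContDiffOn ℝ ∞ xdes (Ici 0))
    (hρ₀ : 0 < ρ₀) (hρinf : 0 < ρinf) (hμ : 0 < μ)
    (hinit : |QSMC.sigma c xdes 0 x₀| < ρ₀) :
    -- every closed-loop trajectory on a finite interval respects the reaching law
    (∀ (T : ℝ) (x : ℝ → Fin (m + 1) → ℝ), 0 < T → x 0 = x₀ →
      QSMC.IsTrajectoryOn f g d (QSMC.control g c xdes ρ₀ ρinf μ) (Ico 0 T) x →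
      ∀ t ∈ Ico 0 T, |QSMC.sigma c xdes t (x t)| < QSMC.rho ρ₀ ρinf μ t) ∧
    -- for continuous `g`: global trajectories exist and no trajectory stops in finite time
    (Continuous g →
      (∃ x : ℝ → Fin (m + 1) → ℝ, x 0 = x₀ ∧
        QSMC.IsTrajectoryOn f g d (QSMC.control g c xdes ρ₀ ρinf μ) (Ici 0) x) ∧
      (∀ (T : ℝ) (x : ℝ → Fin (m + 1) → ℝ), 0 < T → x 0 = x₀ →
        QSMC.IsTrajectoryOn f g d (QSMC.control g c xdes ρ₀ ρinf μ) (Ico 0 T) x →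
        ∃ y : ℝ → Fin (m + 1) → ℝ, EqOn y x (Ico 0 T) ∧
          QSMC.IsTrajectoryOn f g d (QSMC.control g c xdes ρ₀ ρinf μ) (Ici 0) y)) ∧
    -- every global closed-loop trajectory: reaching law, quasi-sliding mode, tracking
    (∀ x : ℝ → Fin (m + 1) → ℝ, x 0 = x₀ →
      QSMC.IsTrajectoryOn f g d (QSMC.control g c xdes ρ₀ ρinf μ) (Ici 0) x →
      (∀ t : ℝ, 0 ≤ t → |QSMC.sigma c xdes t (x t)| < QSMC.rho ρ₀ ρinf μ t) ∧
      ∀ ε : ℝ, ρinf < ε → ε < ρ₀ →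
        (∃ tr : ℝ, 0 ≤ tr ∧ tr < 1 / μ * Real.log (ρ₀ / (ε - ρinf)) ∧
          QSMC.InQSM (fun t => QSMC.sigma c xdes t (x t)) ε tr ∧
          ∀ t : ℝ, tr ≤ t → |QSMC.sigma c xdes t (x t)| < ε) ∧
        ∀ a : ℝ, 0 < a →
          (∀ j : Fin m, c j = (m.choose (m - (j : ℕ)) : ℝ) * a ^ (m - (j : ℕ))) →
          ∃ T : ℝ, ∀ t : ℝ, T ≤ t →
            |QSMC.err xdes t (x t) 0| < ε / a ^ m ∧
            ∀ i : Fin (m + 1),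
              |QSMC.err xdes t (x t) i| < (2 * a) ^ (i : ℕ) * (ε / a ^ m)) := by
  obtain ⟨gl, hgl, hg⟩ := hg
  obtain ⟨db, -, hdb⟩ := hdb
  have h0 : |QSMC.sigma c xdes 0 x₀| < QSMC.rho ρ₀ ρinf μ 0 :=
    hinit.trans_le (by simp [QSMC.rho, hρinf.le])
  have reach : ∀ (T : ℝ) (x : ℝ → Fin (m + 1) → ℝ), x 0 = x₀ →
      QSMC.IsTrajectoryOn f g d (QSMC.control g c xdes ρ₀ ρinf μ) (Ico 0 T) x →
      ∀ t ∈ Ico 0 T, |QSMC.sigma c xdes t (x t)| < QSMC.rho ρ₀ ρinf μ t := fun T x hx0 h =>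
    h.abs_sigma_lt_rho hf hxdes hd hdb hgl hg hρ₀ hρinf hμ (by rwa [hx0])
  refine ⟨fun T x _ hx0 h => reach T x hx0 h, fun hgc => ⟨?_, fun T x hT hx0 h => ?_⟩,
    fun x hx0 h => ?_⟩
  -- Existence is the extension of a trajectory on the empty interval `[0, 0)`.
  · have htriv : QSMC.IsTrajectoryOn f g d (QSMC.control g c xdes ρ₀ ρinf μ) (Ico 0 0)
        fun _ => x₀ := ⟨by simp, by simp, by simp⟩
    obtain ⟨y, hy0, -, hy⟩ := htriv.exists_extension hf hgc hxdes hd hdb hgl hg hρ₀ hρinf hμ h0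
    exact ⟨y, hy0, hy⟩
  · obtain ⟨y, -, hyx, hy⟩ := h.exists_extension hf hgc hxdes hd hdb hgl hg hρ₀ hρinf hμ
      (by rwa [hx0])
    exact ⟨y, hyx, hy⟩
  · have hσ : ∀ t : ℝ, 0 ≤ t → |QSMC.sigma c xdes t (x t)| < QSMC.rho ρ₀ ρinf μ t := fun t ht =>
      reach (t + 1) x hx0 (h.mono Ico_subset_Ici_self) t ⟨ht, lt_add_one t⟩
    refine ⟨hσ, fun ε hε hερ => ⟨?_, fun a ha hc => ?_⟩⟩
    · obtain ⟨tr, htr0, htr, hlt⟩ := QSMC.exists_reaching_time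
        (QSMC.continuousOn_graph subset_rfl h.continuousOn (QSMC.continuousOn_sigma (c := c) hxdes))
        hσ hρ₀ hρinf hμ hε hερ
      exact ⟨tr, htr0, htr, fun t ht => (hlt t ht.le).le, hlt⟩
    · have hall := eventually_all.2 fun i : Fin (m + 1) =>
        h.eventually_abs_err_lt hxdes hμ hσ ha hc hε i
      obtain ⟨T, hT⟩ := eventually_atTop.1 hall
      exact ⟨T, fun t ht => ⟨by simpa using hT t ht 0, hT t ht⟩⟩
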